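/- Multistage 2-SAT is the following decision problem. An instance consists of a nonempty finite set $X$ of $n$ variables, a sequence $\Phi=(\mathcal C_1,\dots,\mathcal C_\tau)$, $\tau\ge 1$, of formulas in conjunctive normal form over $X$ whose clauses have at most two literals each, and an integer $d\ge 0$. The question is whether there are truth assignments $f_1,\dots,f_\tau\colon X\to\{\bot,\top\}$ such that $f_i$ satisfies $\mathcal C_i$ for every $i\in\{1,\dots,\tau\}$ and $|\{x\in X\mid f_i(x)\ne f_{i+1}(x)\}|\le d$ for every $i\in\{1,\dots,\tau-1\}$. Let $m$ be the maximum number of clauses in any $\mathcal C_i$, and let $n-d$ be read as $0$ when $d>n$. Theorem. Multistage 2-SAT is solvable in $O\bigl(n^{4(n-d)+1}\cdot 2^{4(n-d)}\cdot\tau\,(n+m)\bigr)$ time: there are one algorithm on a word RAM (unit-cost addition, subtraction, tests and memory access on words whose length is logarithmic in the time bound plus the length and the largest number of the input) and one constant $C$ such that the algorithm decides every instance in at most $C\cdot n^{4(n-d)+1}\cdot 2^{4(n-d)}\cdot\tau\,(n+m)$ steps. Moreover, Multistage 2-SAT is in XP for the parameter $p=n-d$: there are an algorithm in the same machine model and a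 computable function $g\colon\mathbb N_0\to\mathbb N_0$ such that every instance with parameter $p$, written as an input $x$ of $|x|$ bits (in which the variables are listed) together with $p$, is decided in at most $|x|^{g(p)}+g(p)$ steps. -/

import Mathlib

/-! ## The machine model: structured programs on a word RAM

A machine has registers and a random access memory, both holding natural numbers.  Its only
arithmetic is addition and truncated subtraction, and every operation costs one step.  Words are
bounded: a number larger than the word bound `W` can not be formed, an execution that would form
one does not exist. -/

/-- The state of the machine: contents of the registers and of the memory cells. -/
structure RState where
  reg : ℕ → ℕ
  mem : ℕ → ℕ

/-- Expressions: a constant, a register, the memory cell at a computed address, a sum, a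
truncated difference. -/
inductive RExpr where
  | const (c : ℕ)
  | reg (r : ℕ)
  | mem (e : RExpr)
  | add (e₁ e₂ : RExpr)
  | sub (e₁ e₂ : RExpr)

namespace RExpr

/-- The value of an expression in a state. -/
def eval (s : RState) : RExpr → ℕ
  | const c => c
  | reg r => s.reg r
  | mem e => s.mem (e.eval s)
  | add e₁ e₂ => e₁.eval s + e₂.eval s
  | sub e₁ e₂ => e₁.eval s - e₂.eval s

/-- The number of steps to evaluate an expression: its number of nodes. -/
def cost : RExpr → ℕ
  | const _ => 1
  | reg _ => 1
  | mem e => e.cost + 1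
  | add e₁ e₂ => e₁.cost + e₂.cost + 1
  | sub e₁ e₂ => e₁.cost + e₂.cost + 1

/-- All numbers that occur in the evaluation of the expression (addresses and intermediate
results included) are at most the word bound `W`. -/
def Fits (W : ℕ) (s : RState) : RExpr → Prop
  | const c => c ≤ W
  | reg r => s.reg r ≤ W
  | mem e => e.Fits W s ∧ s.mem (e.eval s) ≤ W
  | add e₁ e₂ => e₁.Fits W s ∧ e₂.Fits W s ∧ e₁.eval s + e₂.eval s ≤ W
  | sub e₁ e₂ => e₁.Fits W s ∧ e₂.Fits W s

end RExpr

/-- Programs. -/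
inductive RProg where
  | skip
  /-- put the value of `e` into register `r` -/
  | assign (r : ℕ) (e : RExpr)
  /-- put the value of `e` into the memory cell whose address is the value of `a` -/
  | store (a e : RExpr)
  | seq (p q : RProg)
  /-- execute `p` if the value of `e` is not zero, and `q` otherwise -/
  | branch (e : RExpr) (p q : RProg)
  /-- repeat `p` as long as the value of `e` is not zero -/
  | loop (e : RExpr) (p : RProg)

/-- `RExec W p s t s'`: with word bound `W`, the program `p` started in the state `s` halts after
exactly `t` steps in the state `s'`. -/
inductive RExec (W : ℕ) : RProg → RState → ℕ → RState → Prop where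
  | skip (s : RState) : RExec W .skip s 1 s
  | assign (r : ℕ) (e : RExpr) (s : RState) (he : e.Fits W s) :
      RExec W (.assign r e) s (e.cost + 1) { s with reg := Function.update s.reg r (e.eval s) }
  | store (a e : RExpr) (s : RState) (ha : a.Fits W s) (he : e.Fits W s) :
      RExec W (.store a e) s (a.cost + e.cost + 1)
        { s with mem := Function.update s.mem (a.eval s) (e.eval s) }
  | seq {p q : RProg} {s s' s'' : RState} {t t' : ℕ}
      (hp : RExec W p s t s') (hq : RExec W q s' t' s'') :
      RExec W (.seq p q) s (t + t') s''
  | branchTrue {e : RExpr} {p q : RProg} {s s' : RState} {t : ℕ} (he : e.Fits W s)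
      (h : e.eval s ≠ 0) (hp : RExec W p s t s') :
      RExec W (.branch e p q) s (e.cost + 1 + t) s'
  | branchFalse {e : RExpr} {p q : RProg} {s s' : RState} {t : ℕ} (he : e.Fits W s)
      (h : e.eval s = 0) (hq : RExec W q s t s') :
      RExec W (.branch e p q) s (e.cost + 1 + t) s'
  | loopTrue {e : RExpr} {p : RProg} {s s' s'' : RState} {t t' : ℕ} (he : e.Fits W s)
      (h : e.eval s ≠ 0) (hp : RExec W p s t s') (hl : RExec W (.loop e p) s' t' s'') :
      RExec W (.loop e p) s (e.cost + 1 + t + t') s''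
  | loopFalse {e : RExpr} {p : RProg} {s : RState} (he : e.Fits W s) (h : e.eval s = 0) :
      RExec W (.loop e p) s (e.cost + 1) s

/-- The initial state on the input `x`: the words of `x` in the memory cells `0, 1, 2, …`, the
length of `x` in register `0`, and zero everywhere else. -/
def RState.init (x : List ℕ) : RState where
  reg := Function.update (fun _ => 0) 0 x.length
  mem := fun a => x.getD a 0

/-- On the input `x` the program halts after at most `T` steps and accepts (ends with `1` in
register `0`) if and only if `b` holds.  The numbers it forms stay below the time bound plus the
length and the largest word of the input, so that words have logarithmic length. -/
def RProg.DecidesIn (P : RProg) (x : List ℕ) (b : Prop) (T : ℕ) : Prop :=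
  ∃ t s, t ≤ T ∧ RExec (T + x.length + x.foldr max 0) P (RState.init x) t s ∧ (s.reg 0 = 1 ↔ b)

/-! ## Parameterized problems and the class XP -/

/-- The length in bits of an input that is written as a list of numbers in binary, with one
separating symbol after each number. -/
def bitLength (x : List ℕ) : ℕ := (x.map fun a => a.size + 1).sum

/-- The parameterized problem with instances `I : α`, written as `enc I`, with parameter
`param I` and yes-instances `Yes`, is in XP: some program decides every instance with input
`(x, p)`, where `x = enc I` and `p = param I`, in at most `|x| ^ g p + g p` steps, for a
computable function `g`. -/
def InXP {α : Type} (enc : α → List ℕ) (param : α → ℕ) (Yes : α → Prop) : Prop :=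
  ∃ (P : RProg) (g : ℕ → ℕ), Computable g ∧ ∀ I : α,
    P.DecidesIn (enc I ++ [param I]) (Yes I) (bitLength (enc I) ^ g (param I) + g (param I))

/-! ## Multistage 2-SAT -/

/-- A literal over the variables `Fin n`: a variable and its sign (`true` for positive). -/
abbrev Literal (n : ℕ) := Fin n × Bool

/-- A clause with at most two literals. -/
abbrev Clause2 (n : ℕ) := { c : List (Literal n) // c.length ≤ 2 }

/-- A formula in 2-CNF: a conjunction of clauses with at most two literals each. -/
abbrev Formula2 (n : ℕ) := List (Clause2 n)

/-- The assignment `f` satisfies the formula `φ`. -/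
def Formula2.SatBy {n : ℕ} (φ : Formula2 n) (f : Fin n → Bool) : Prop :=
  ∀ c ∈ φ, ∃ l ∈ c.1, f l.1 = l.2

/-- An instance of Multistage 2-SAT: a nonempty set of `n` variables, a sequence of `τ ≥ 1`
formulas in 2-CNF over them, and a number `d`. -/
structure M2SAT where
  n : ℕ
  n_pos : 0 < n
  τ : ℕ
  τ_pos : 0 < τ
  Φ : Fin τ → Formula2 n
  d : ℕ

namespace M2SAT

/-- The maximum number of clauses in any stage. -/
def m (I : M2SAT) : ℕ := Finset.univ.sup fun i => (I.Φ i).length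

/-- There are assignments satisfying the formulas of their stages such that between any two
consecutive stages at most `d` variables change their value. -/
def Yes (I : M2SAT) : Prop :=
  ∃ f : Fin I.τ → Fin I.n → Bool,
    (∀ i, (I.Φ i).SatBy (f i)) ∧
    ∀ i j : Fin I.τ, (i : ℕ) + 1 = j →
      (Finset.univ.filter fun x => f i x ≠ f j x).card ≤ I.d

/-- A literal is written as its variable followed by its sign. -/
def encLiteral {n : ℕ} (l : Literal n) : List ℕ := [(l.1 : ℕ), if l.2 then 1 else 0]

/-- A clause is written as its number of literals followed by the literals. -/
def encClause {n : ℕ} (c : Clause2 n) : List ℕ := c.1.length :: c.1.flatMap encLiteral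

/-- A formula is written as its number of clauses followed by the clauses. -/
def encFormula {n : ℕ} (φ : Formula2 n) : List ℕ := φ.length :: φ.flatMap encClause

/-- An instance is written as the numbers `n`, `d`, `τ`, the list of the variables, and the
formulas of the stages in order. -/
def encode (I : M2SAT) : List ℕ :=
  [I.n, I.d, I.τ] ++ List.range I.n ++ (List.ofFn fun i => encFormula (I.Φ i)).flatten

/-- The parameter `n - d`, read as `0` if `d ≥ n`. -/
def dual (I : M2SAT) : ℕ := I.n - I.d

end M2SAT

/-! ## A program logic with running times -/

/-! Two assignments differ on at most `d` variables exactly if they agree on at least `p = n - d`,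
that is, if both make true a common set of `p` literals. Such a set is coded by a number `k < N =
(2n)^p` whose base-`2n` digits are the literals; codes with a repeated digit are rejected. Hence an
instance is a yes-instance iff there are codes `κ 0, …, κ τ` such that each stage `i` has a
satisfying assignment extending both `κ i` and `κ (i + 1)` (`mem_reach_iff`, `reach_nonempty_iff`).
The stages interact only through these codes, so a dynamic program that keeps the set of reachable
codes needs `N^2` tests per stage.

Each test is 2-SAT with some literals fixed, solved by limited backtracking. A set of literals that
is closed under propagation and free of conflicts may always be adopted, because every satisfying
assignment can be changed to agree with it (`exists_sat_agrees`). Two candidate sets are propagated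
in parallel, one scan of the formula per round. Once one of them is closed and conflict-free, the
other is discarded, and the survivor is branched on an unassigned variable. After `r` rounds a
conflict-free candidate has at least `r` literals or is closed and assigns every variable; as a
conflict-free set has at most `n` literals, `n + 1` rounds settle the question (`SolveInv.sat_iff`).
A round costs `O(n + m)`, and decoding the two codes by repeated subtraction costs `O(pN)`.

In total the time is `O(τ N^2 · N n (n + m))`, which lies within `N^4 n τ (n + m) = n^(4p+1) 2^(4p)
τ (n + m)`. The input length is at least `n`, `m` and `τ`, so the same program gives the XP bound
with a linear `g`.

On the machine, register 0 is the end of the input and the start of the working memory; registers 1,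
2, 3, 6 hold `n`, `p`, `2n`, `N`. The candidate sets are arrays at registers 0 and 4, the old and
new reachable codes arrays at registers 5 and 7. Registers 9 and 12 are the start and the end of the
current formula, 10 and 11 the two codes, 13 an error flag; registers from 20 on are scratch. -/

namespace RState

/-- Put `v` into register `r`. -/
def setr (s : RState) (r v : ℕ) : RState := { s with reg := Function.update s.reg r v }

/-- Put `v` into the memory cell `a`. -/
def setm (s : RState) (a v : ℕ) : RState := { s with mem := Function.update s.mem a v }

@[simp] theorem setr_reg (s : RState) (r v i : ℕ) :
    (s.setr r v).reg i = if i = r then v else s.reg i := by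
  simp [setr, Function.update_apply]

@[simp] theorem setr_mem (s : RState) (r v : ℕ) : (s.setr r v).mem = s.mem := rfl

@[simp] theorem setm_reg (s : RState) (a v : ℕ) : (s.setm a v).reg = s.reg := rfl

@[simp] theorem setm_mem (s : RState) (a v i : ℕ) :
    (s.setm a v).mem i = if i = a then v else s.mem i := by
  simp [setm, Function.update_apply]

end RState

/-- The program halts from `s`, and its running time and final state satisfy `Q`. -/
def Wp (W : ℕ) (p : RProg) (s : RState) (Q : ℕ → RState → Prop) : Prop :=
  ∃ t s', RExec W p s t s' ∧ Q t s'

/-- The program halts from `s` after at most `T` steps in a state satisfying `Q`. -/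
def Run (W : ℕ) (p : RProg) (s : RState) (T : ℕ) (Q : RState → Prop) : Prop :=
  Wp W p s fun t s' => t ≤ T ∧ Q s'

section Rules

variable {W : ℕ} {s : RState} {Q : ℕ → RState → Prop}

/-- Inverting `RExec` yields equivalences for the loop-free constructs, so rewriting turns a
straight-line program into its `Fits` conditions and a claim about the final time and state. Loops
are handled by invariants instead. -/
theorem wp_skip : Wp W .skip s Q ↔ Q 1 s := by
  constructor
  · rintro ⟨t, s', h, hQ⟩; cases h; exact hQ
  · exact fun h => ⟨_, _, .skip s, h⟩

theorem wp_assign {r : ℕ} {e : RExpr} :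
    Wp W (.assign r e) s Q ↔ e.Fits W s ∧ Q (e.cost + 1) (s.setr r (e.eval s)) := by
  constructor
  · rintro ⟨t, s', h, hQ⟩; cases h with | assign _ _ _ he => exact ⟨he, hQ⟩
  · exact fun h => ⟨_, _, .assign r e s h.1, h.2⟩

theorem wp_store {a e : RExpr} :
    Wp W (.store a e) s Q ↔
      a.Fits W s ∧ e.Fits W s ∧ Q (a.cost + e.cost + 1) (s.setm (a.eval s) (e.eval s)) := by
  constructor
  · rintro ⟨t, s', h, hQ⟩; cases h with | store _ _ _ ha he => exact ⟨ha, he, hQ⟩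
  · exact fun h => ⟨_, _, .store a e s h.1 h.2.1, h.2.2⟩

theorem wp_seq {p q : RProg} :
    Wp W (.seq p q) s Q ↔ Wp W p s fun t s' => Wp W q s' fun t' s'' => Q (t + t') s'' := by
  constructor
  · rintro ⟨t, s', h, hQ⟩
    cases h with | seq hp hq => exact ⟨_, _, hp, _, _, hq, hQ⟩
  · rintro ⟨t, s', hp, t', s'', hq, hQ⟩
    exact ⟨_, _, .seq hp hq, hQ⟩

theorem wp_branch {e : RExpr} {p q : RProg} :
    Wp W (.branch e p q) s Q ↔ e.Fits W s ∧
      (e.eval s ≠ 0 → Wp W p s fun t s' => Q (e.cost + 1 + t) s') ∧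
      (e.eval s = 0 → Wp W q s fun t s' => Q (e.cost + 1 + t) s') := by
  constructor
  · rintro ⟨t, s', h, hQ⟩
    cases h with
    | branchTrue he h hp => exact ⟨he, fun _ => ⟨_, _, hp, hQ⟩, fun h' => absurd h' h⟩
    | branchFalse he h hp => exact ⟨he, fun h' => absurd h h', fun _ => ⟨_, _, hp, hQ⟩⟩
  · rintro ⟨he, h1, h2⟩
    by_cases h : e.eval s = 0
    · obtain ⟨t, s', hq, hQ⟩ := h2 h
      exact ⟨_, _, .branchFalse he h hq, hQ⟩
    · obtain ⟨t, s', hq, hQ⟩ := h1 h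
      exact ⟨_, _, .branchTrue he h hq, hQ⟩

theorem wp_loop_true {e : RExpr} {p : RProg} (he : e.Fits W s) (h : e.eval s ≠ 0)
    (hp : Wp W p s fun t s' => Wp W (.loop e p) s' fun t' s'' => Q (e.cost + 1 + t + t') s'') :
    Wp W (.loop e p) s Q := by
  obtain ⟨t, s', hp, t', s'', hq, hQ⟩ := hp
  exact ⟨_, _, .loopTrue he h hp hq, hQ⟩

theorem wp_loop_false {e : RExpr} {p : RProg} (he : e.Fits W s) (h : e.eval s = 0)
    (hQ : Q (e.cost + 1) s) : Wp W (.loop e p) s Q :=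
  ⟨_, _, .loopFalse he h, hQ⟩

theorem Wp.mono {p : RProg} {Q' : ℕ → RState → Prop} (h : Wp W p s Q)
    (hQ : ∀ t s', Q t s' → Q' t s') : Wp W p s Q' := by
  obtain ⟨t, s', h1, h2⟩ := h
  exact ⟨t, s', h1, hQ _ _ h2⟩

theorem Run.wp {p : RProg} {T : ℕ} {Q' : RState → Prop} (h : Run W p s T Q')
    (hQ : ∀ t s', t ≤ T → Q' s' → Q t s') : Wp W p s Q :=
  Wp.mono h fun t s' h => hQ t s' h.1 h.2

theorem Run.mono {p : RProg} {T T' : ℕ} {Q Q' : RState → Prop} (h : Run W p s T Q)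
    (hT : T ≤ T') (hQ : ∀ s', Q s' → Q' s') : Run W p s T' Q' :=
  Wp.mono h fun _ s' h => ⟨h.1.trans hT, hQ s' h.2⟩

end Rules

/-- Execute `body` with register `r` running from `e - 1` down to `0`. -/
def RProg.forDown (r : ℕ) (e : RExpr) (body : RProg) : RProg :=
  .seq (.assign r e) (.loop (.reg r) (.seq (.assign r (.sub (.reg r) (.const 1))) body))

/-- Each iteration pays 2 steps for the test and 4 for the decrement besides the body, and the
failing test at the end costs 2. The body sees the counter already decremented and has to leave it
unchanged. -/
theorem run_countdown {W r T : ℕ} {body : RProg} (Inv : ℕ → RState → Prop) (h1 : 1 ≤ W) {K : ℕ}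
    (hK : K ≤ W)
    (step : ∀ k s, k < K → Inv (k + 1) s →
      Run W body (s.setr r k) T fun s' => s'.reg r = k ∧ Inv k s')
    (s : RState) (hr : s.reg r = K) (h : Inv K s) :
    Run W (.loop (.reg r) (.seq (.assign r (.sub (.reg r) (.const 1))) body)) s
      (K * (T + 6) + 2) fun s' => Inv 0 s' := by
  induction K generalizing s with
  | zero =>
    exact wp_loop_false (by simp [RExpr.Fits, hr]) (by simp [RExpr.eval, hr])
      ⟨by simp [RExpr.cost], h⟩
  | succ K ih =>
    refine wp_loop_true (by simp [RExpr.Fits, hr, hK]) (by simp [RExpr.eval, hr]) ?_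
    rw [wp_seq, wp_assign]
    refine ⟨by simp [RExpr.Fits, hr, hK, h1], ?_⟩
    simp only [RExpr.eval, hr, Nat.add_sub_cancel, RExpr.cost]
    refine (step K s (Nat.lt_succ_self K) h).wp ?_
    intro t s' ht hs'
    refine (ih (by omega) (fun k s hk => step k s (by omega)) s' hs'.1 hs'.2).wp ?_
    intro t' s'' ht' hs''
    refine ⟨?_, hs''⟩
    rw [Nat.succ_mul]
    omega

/-- The rule for counting loops: `Inv k` holds whenever the counter is `k`. -/
theorem run_forDown {W r T K : ℕ} {body : RProg} {e : RExpr} {s : RState}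
    (Inv : ℕ → RState → Prop) (h1 : 1 ≤ W) (hK : K ≤ W) (he : e.eval s = K) (hf : e.Fits W s)
    (h : Inv K (s.setr r K))
    (step : ∀ k s, k < K → Inv (k + 1) s →
      Run W body (s.setr r k) T fun s' => s'.reg r = k ∧ Inv k s') :
    Run W (.forDown r e body) s (K * (T + 6) + e.cost + 3) (Inv 0) := by
  unfold RProg.forDown
  unfold Run
  rw [wp_seq, wp_assign, he]
  refine ⟨hf, ?_⟩
  refine (run_countdown Inv h1 hK step _ (by simp) h).wp ?_
  intro t s' ht hs'
  exact ⟨by omega, hs'⟩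

/-! ## Sets stored as arrays -/

/-- The cells `base, …, base + len - 1` hold the characteristic function of `L`. -/
def Arr (mem : ℕ → ℕ) (base len : ℕ) (L : Finset ℕ) : Prop :=
  ∀ e < len, mem (base + e) = if e ∈ L then 1 else 0

theorem Arr.congr {mem mem' : ℕ → ℕ} {base len : ℕ} {L : Finset ℕ} (h : Arr mem base len L)
    (h' : ∀ a, base ≤ a → a < base + len → mem' a = mem a) : Arr mem' base len L := by
  intro e he
  rw [h' _ (by omega) (by omega), h e he]

theorem Arr.le_one {mem : ℕ → ℕ} {base len : ℕ} {L : Finset ℕ} (h : Arr mem base len L) {e : ℕ}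
    (he : e < len) : mem (base + e) ≤ 1 := by
  rw [h e he]; split <;> simp

theorem Arr.eq_zero_iff {mem : ℕ → ℕ} {base len : ℕ} {L : Finset ℕ} (h : Arr mem base len L)
    {e : ℕ} (he : e < len) : mem (base + e) = 0 ↔ e ∉ L := by
  rw [h e he]; split <;> simp_all

theorem Arr.setm {s : RState} {base len : ℕ} {L : Finset ℕ} (h : Arr s.mem base len L) (e : ℕ) :
    Arr (s.setm (base + e) 1).mem base len (insert e L) := by
  intro i hi
  by_cases hie : i = e
  · simp [hie]
  · simp [hie, h i hi]

/-- Memory and registers below `c` agree, except for the cells `base, …, base + len - 1`. -/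
def Frame (s s' : RState) (c base len : ℕ) : Prop :=
  (∀ r < c, s'.reg r = s.reg r) ∧ ∀ a, a < base ∨ base + len ≤ a → s'.mem a = s.mem a

/-! ## Array subroutines -/

namespace RProg

/-- Fill the array at (register) `b` of length (register) `len` with `v`. -/
def fill (b len v : ℕ) : RProg :=
  .forDown 30 (.reg len) (.store (.add (.reg b) (.reg 30)) (.const v))

/-- Copy the array at `src` of length `len` to `dst`. -/
def copy (src dst len : ℕ) : RProg :=
  .forDown 30 (.reg len)
    (.store (.add (.reg dst) (.reg 30)) (.mem (.add (.reg src) (.reg 30))))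

/-- Replace the arrays at `a` and `b` by their union. -/
def merge (a b len : ℕ) : RProg :=
  .forDown 30 (.reg len)
    (.branch (.add (.mem (.add (.reg a) (.reg 30))) (.mem (.add (.reg b) (.reg 30))))
      (.seq (.store (.add (.reg a) (.reg 30)) (.const 1))
        (.store (.add (.reg b) (.reg 30)) (.const 1)))
      .skip)

/-- Put `0` into register `31` if and only if the array at `b` of length `len` is zero. -/
def anyIn (b len : ℕ) : RProg :=
  .seq (.assign 31 (.const 0))
    (.forDown 30 (.reg len)
      (.branch (.mem (.add (.reg b) (.reg 30))) (.assign 31 (.const 1)) .skip))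

end RProg

theorem run_fill {W : ℕ} {b len v : ℕ} {s : RState} (hb : b < 30) (h1 : 1 ≤ W)
    (hv : v ≤ W) (hW : s.reg b + s.reg len ≤ W) :
    Run W (.fill b len v) s (s.reg len * 11 + 4) fun s' =>
      Frame s s' 30 (s.reg b) (s.reg len) ∧ ∀ e < s.reg len, s'.mem (s.reg b + e) = v := by
  have key := run_forDown (W := W) (r := 30) (T := 5) (K := s.reg len) (e := .reg len) (s := s)
    (body := .store (.add (.reg b) (.reg 30)) (.const v))
    (fun k s' => Frame s s' 30 (s.reg b) (s.reg len) ∧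
      ∀ e < s.reg len, k ≤ e → s'.mem (s.reg b + e) = v) h1 (by omega) rfl
    (by simp [RExpr.Fits]; omega)
    ⟨⟨fun r hr => by simp [hr.ne], fun a _ => rfl⟩, fun e h h' => by omega⟩ ?_
  · refine key.mono (by simp [RExpr.cost]) fun s' h => ⟨h.1, fun e he => h.2 e he (Nat.zero_le _)⟩
  · rintro k s' hk ⟨⟨hr, hm⟩, ha⟩
    simp only [Run, wp_store, RExpr.Fits, RExpr.eval, RExpr.cost, RState.setr_reg, hb.ne, hr b hb,
      if_true, if_false]
    refine ⟨by omega, hv, by omega, by simp, ⟨fun r h => ?_, fun a h => ?_⟩, fun e h h' => ?_⟩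
    · simp [h.ne, hr r h]
    · have : a ≠ s.reg b + k := by omega
      simp [this, hm a h]
    · rcases Nat.eq_or_lt_of_le h' with rfl | h'
      · simp
      · simp [h'.ne', ha e h h']

theorem run_fill_zero {W : ℕ} {b len : ℕ} {s : RState} (hb : b < 30) (h1 : 1 ≤ W)
    (hW : s.reg b + s.reg len ≤ W) :
    Run W (.fill b len 0) s (s.reg len * 11 + 4) fun s' =>
      Frame s s' 30 (s.reg b) (s.reg len) ∧ Arr s'.mem (s.reg b) (s.reg len) ∅ :=
  (run_fill hb h1 (Nat.zero_le _) hW).mono le_rfl fun _ h =>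
    ⟨h.1, fun e he => by simp [h.2 e he]⟩

theorem run_copy {W : ℕ} {src dst len : ℕ} {s : RState} {L : Finset ℕ} (hb : src < 30)
    (hd : dst < 30) (h1 : 1 ≤ W)
    (hW : s.reg src + s.reg len ≤ W) (hW' : s.reg dst + s.reg len ≤ W)
    (hdis : s.reg src + s.reg len ≤ s.reg dst ∨ s.reg dst + s.reg len ≤ s.reg src)
    (hL : Arr s.mem (s.reg src) (s.reg len) L) :
    Run W (.copy src dst len) s (s.reg len * 14 + 4) fun s' =>
      Frame s s' 30 (s.reg dst) (s.reg len) ∧ Arr s'.mem (s.reg dst) (s.reg len) L := by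
  have key := run_forDown (W := W) (r := 30) (T := 8) (K := s.reg len) (e := .reg len) (s := s)
    (body := .store (.add (.reg dst) (.reg 30)) (.mem (.add (.reg src) (.reg 30))))
    (fun k s' => Frame s s' 30 (s.reg dst) (s.reg len) ∧
      ∀ e < s.reg len, k ≤ e → s'.mem (s.reg dst + e) = if e ∈ L then 1 else 0) h1 (by omega) rfl
    (by simp [RExpr.Fits]; omega)
    ⟨⟨fun r hr => by simp [hr.ne], fun a _ => rfl⟩, fun e h h' => by omega⟩ ?_
  · refine key.mono (by simp [RExpr.cost]) fun s' h => ⟨h.1, fun e he => h.2 e he (Nat.zero_le _)⟩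
  · rintro k s' hk ⟨⟨hr, hm⟩, ha⟩
    have hsrc : s'.mem (s.reg src + k) = if k ∈ L then 1 else 0 := by
      rw [hm _ (by omega), hL k hk]
    have hle : s'.mem (s.reg src + k) ≤ W := by rw [hsrc]; split <;> omega
    simp only [Run, wp_store, RExpr.Fits, RExpr.eval, RExpr.cost, RState.setr_reg, hb.ne, hr src hb,
      hr dst hd, hd.ne, if_true, if_false, RState.setr_mem]
    refine ⟨by omega, ⟨by omega, hle⟩, by omega, by simp, ⟨fun r h => ?_, fun a h => ?_⟩,
      fun e h h' => ?_⟩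
    · simp [h.ne, hr r h]
    · have : a ≠ s.reg dst + k := by omega
      simp [this, hm a h]
    · rcases Nat.eq_or_lt_of_le h' with rfl | h'
      · simp [hsrc]
      · simp [h'.ne', ha e h h']

theorem run_merge {W : ℕ} {a b len : ℕ} {s : RState} {L M : Finset ℕ} (ha : a < 30)
    (hb : b < 30) (h1 : 2 ≤ W) (hab : s.reg a + s.reg len = s.reg b)
    (hW : s.reg b + s.reg len ≤ W)
    (hL : Arr s.mem (s.reg a) (s.reg len) L) (hM : Arr s.mem (s.reg b) (s.reg len) M) :
    Run W (.merge a b len) s (s.reg len * 26 + 4) fun s' =>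
      Frame s s' 30 (s.reg a) (s.reg len + s.reg len) ∧
      Arr s'.mem (s.reg a) (s.reg len) (L ∪ M) ∧ Arr s'.mem (s.reg b) (s.reg len) (L ∪ M) := by
  have key := run_forDown (W := W) (r := 30) (T := 20) (K := s.reg len) (e := .reg len) (s := s)
    (body := (.branch (.add (.mem (.add (.reg a) (.reg 30))) (.mem (.add (.reg b) (.reg 30))))
      (.seq (.store (.add (.reg a) (.reg 30)) (.const 1))
        (.store (.add (.reg b) (.reg 30)) (.const 1)))
      .skip))
    -- Cells with index at least `k` already hold the union; below `k` each array still holds its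
    -- own set.
    (fun k s' => Frame s s' 30 (s.reg a) (s.reg len + s.reg len) ∧
      (∀ e < s.reg len, s'.mem (s.reg a + e) =
        if e ∈ L ∨ (k ≤ e ∧ e ∈ M) then 1 else 0) ∧
      (∀ e < s.reg len, s'.mem (s.reg b + e) =
        if e ∈ M ∨ (k ≤ e ∧ e ∈ L) then 1 else 0)) (by omega) (by omega) rfl
    (by simp [RExpr.Fits]; omega)
    ⟨⟨fun r hr => by simp [hr.ne], fun a _ => rfl⟩, fun e h => by simp [h.not_ge, hL e h],
      fun e h => by simp [h.not_ge, hM e h]⟩ ?_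
  · refine key.mono (by simp [RExpr.cost]) fun s' h => ⟨h.1, fun e he => ?_, fun e he => ?_⟩
    · simp [h.2.1 e he]
    · simp [h.2.2 e he, or_comm]
  · rintro k s' hk ⟨⟨hr, hm⟩, hA, hB⟩
    have hA' := hA k hk
    have hB' := hB k hk
    have hle1 : s'.mem (s.reg a + k) ≤ 1 := by rw [hA']; split <;> simp
    have hle2 : s'.mem (s.reg b + k) ≤ 1 := by rw [hB']; split <;> simp
    simp only [Run, wp_branch, wp_seq, wp_skip, wp_store, RExpr.Fits, RExpr.eval, RExpr.cost,
      RState.setr_reg, ha.ne, hb.ne, hr a ha, hr b hb, if_true, if_false, RState.setr_mem,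
      RState.setm_reg]
    have e0 : ∀ e, e ≠ k → (k + 1 ≤ e ↔ k ≤ e) := by omega
    refine ⟨by omega, fun hne => ?_, fun hz => ?_⟩
    · refine ⟨by omega, by omega, by omega, by omega, by omega, by simp,
        ⟨fun r h => ?_, fun i h => ?_⟩, fun e h => ?_, fun e h => ?_⟩
      · simp [h.ne, hr r h]
      · have h1 : i ≠ s.reg a + k := by omega
        have h2 : i ≠ s.reg b + k := by omega
        simp [h1, h2, hm i h]
      · have h3 : s.reg a + e ≠ s.reg b + k := by omega
        by_cases hek : e = k
        · subst hek
          have : e ∈ L ∨ e ∈ M := by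
            by_contra hcon; push Not at hcon; simp [hA', hB', hcon] at hne
          simp [this]
        · simp [h3, hek, hA e h, e0 e hek]
      · have h3 : s.reg b + e ≠ s.reg a + k := by omega
        by_cases hek : e = k
        · subst hek
          have : e ∈ M ∨ e ∈ L := by
            by_contra hcon; push Not at hcon; simp [hA', hB', hcon] at hne
          simp [this]
        · simp [h3, hek, hB e h, e0 e hek]
    · have hkL : k ∉ L := fun h => by simp [hA', h] at hz
      have hkM : k ∉ M := fun h => by simp [hB', h] at hz
      refine ⟨by omega, by simp, ⟨fun r h => ?_, fun i h => ?_⟩, fun e h => ?_, fun e h => ?_⟩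
      · simp [h.ne, hr r h]
      · simp [hm i h]
      · by_cases hek : e = k
        · subst hek; simp [hkL, hkM, hA']
        · simp [hA e h, e0 e hek]
      · by_cases hek : e = k
        · subst hek; simp [hkL, hkM, hB']
        · simp [hB e h, e0 e hek]

theorem run_anyIn {W : ℕ} {b len : ℕ} {s : RState} {L : Finset ℕ} (hb : b < 30)
    (hl : len < 30) (h1 : 1 ≤ W) (hW : s.reg b + s.reg len ≤ W)
    (hL : Arr s.mem (s.reg b) (s.reg len) L) (hsub : L ⊆ Finset.range (s.reg len)) :
    Run W (.anyIn b len) s (s.reg len * 13 + 6) fun s' => s'.reg 31 ≤ 1 ∧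
      (s'.reg 31 = 1 ↔ L.Nonempty) := by
  simp only [Run, RProg.anyIn, wp_seq, wp_assign, RExpr.Fits, RExpr.eval, RExpr.cost]
  refine ⟨by omega, ?_⟩
  have h31 : len ≠ 31 := by omega
  have r31 : ∀ r < 30, r ≠ 31 := by omega
  have key := run_forDown (W := W) (r := 30) (T := 7) (K := s.reg len) (e := .reg len)
    (s := s.setr 31 0)
    (body := .branch (.mem (.add (.reg b) (.reg 30))) (.assign 31 (.const 1)) .skip)
    (fun k s' => Frame s s' 30 0 0 ∧ s'.reg 31 ≤ 1 ∧ (s'.reg 31 = 1 ↔ ∃ e ∈ L, k ≤ e))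
    h1 (by omega) (by simp [RExpr.eval, h31])
    (by simp [RExpr.Fits, h31]; omega)
    ⟨⟨fun r hr => by simp [hr.ne, r31 r hr], fun a _ => rfl⟩, by simp, ?_⟩ ?_
  · refine key.wp fun t s' ht h => ⟨by simp only [RExpr.cost] at ht; omega, h.2.1, ?_⟩
    rw [h.2.2]
    simp [Finset.Nonempty]
  · simp only [RState.setr_reg]
    simp
    intro x hx
    simpa using hsub hx
  · rintro k s' hk ⟨⟨hr, hm⟩, hle1, hiff⟩
    have hmem : s'.mem (s.reg b + k) = if k ∈ L then 1 else 0 := by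
      rw [hm _ (by omega), hL k hk]
    have hle : s'.mem (s.reg b + k) ≤ 1 := by rw [hmem]; split <;> simp
    simp only [Run, wp_branch, wp_skip, wp_assign, RExpr.Fits, RExpr.eval, RExpr.cost,
      RState.setr_reg, hb.ne, hr b hb, if_true, if_false, RState.setr_mem]
    refine ⟨by omega, fun hne => ?_, fun hz => ?_⟩
    · have hkL : k ∈ L := by by_contra h; simp [hmem, h] at hne
      refine ⟨by omega, by omega, by simp, ⟨fun r h => ?_, fun i h => hm i h⟩, by simp, ?_⟩
      · simp [h.ne, r31 r h, hr r h]
      · simp only [true_iff]; exact ⟨k, hkL, le_rfl⟩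
    · have hkL : k ∉ L := fun h => by simp [hmem, h] at hz
      refine ⟨by omega, by simp, ⟨fun r h => ?_, fun i h => hm i h⟩, by simpa using hle1, ?_⟩
      · simp [h.ne, hr r h]
      · simp only [Nat.reduceEqDiff, if_false, hiff]
        refine exists_congr fun e => and_congr_right fun he => ?_
        have : e ≠ k := fun h => hkL (h ▸ he)
        omega

/-! ## Decoding a number into a set of literals -/

/-- The last `p` digits of `k` in base `b`, the least significant digit first. -/
def digitList (b : ℕ) : ℕ → ℕ → List ℕ
  | 0, _ => []
  | p + 1, k => (k % b) :: digitList b p (k / b)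

theorem digitList_length (b p k : ℕ) : (digitList b p k).length = p := by
  induction p generalizing k with
  | zero => rfl
  | succ p ih => simp [digitList, ih]

theorem digitList_lt {b : ℕ} (hb : 0 < b) {p k e : ℕ} (he : e ∈ digitList b p k) : e < b := by
  induction p generalizing k with
  | zero => simp [digitList] at he
  | succ p ih =>
    rcases List.mem_cons.1 he with rfl | he
    · exact Nat.mod_lt _ hb
    · exact ih he

/-- Horner's scheme: `e + b * k` codes `e :: w` when `k` codes `w`. Thus running through all numbers
below `b ^ p` meets every word of `p` digits. -/
theorem exists_digitList {b : ℕ} (w : List ℕ) (hw : ∀ e ∈ w, e < b) :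
    ∃ k < b ^ w.length, digitList b w.length k = w := by
  induction w with
  | nil => exact ⟨0, by simp, rfl⟩
  | cons e w ih =>
    obtain ⟨k, hk, h⟩ := ih fun e he => hw e (List.mem_cons_of_mem _ he)
    have he : e < b := hw e (by simp)
    have hb : 0 < b := by omega
    refine ⟨e + b * k, ?_, ?_⟩
    · rw [List.length_cons, pow_succ]
      calc e + b * k < b + b * k := by omega
        _ = (k + 1) * b := by ring
        _ ≤ _ := Nat.mul_le_mul_right _ hk
    · simp [digitList, Nat.add_mul_div_left _ _ hb, Nat.div_eq_of_lt he, Nat.mod_eq_of_lt he, h]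

theorem toFinset_concat (w : List ℕ) (e : ℕ) : (w ++ [e]).toFinset = insert e w.toFinset := by
  ext; simp

theorem nodup_concat_iff (w : List ℕ) (e : ℕ) : (w ++ [e]).Nodup ↔ w.Nodup ∧ e ∉ w := by
  rw [List.nodup_append']
  simp

namespace RProg

/-- Divide register `22` by register `3`, with the quotient added to register `23`. -/
def divide : RProg :=
  .loop (.sub (.add (.reg 22) (.const 1)) (.reg 3))
    (.seq (.assign 22 (.sub (.reg 22) (.reg 3))) (.assign 23 (.add (.reg 23) (.const 1))))

/-- Turn the array at `b` into the set of the digits of the number in register `k`, and set the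
flag in register `13` if they are not distinct. -/
def load (b k : ℕ) : RProg :=
  .seq (.fill b 3 0) (.seq (.assign 22 (.reg k)) (.forDown 21 (.reg 2)
    (.seq (.assign 23 (.const 0)) (.seq .divide
      (.seq (.branch (.mem (.add (.reg b) (.reg 22))) (.assign 13 (.const 1))
        (.store (.add (.reg b) (.reg 22)) (.const 1)))
        (.assign 22 (.reg 23)))))))

end RProg

/-- Repeated subtraction, by strong induction on the dividend. The guard `h + 1 - b` in truncated
subtraction is nonzero exactly if `b ≤ h`. An iteration takes 14 steps and lowers the dividend by at
least one, which gives a bound linear in `h`. -/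
theorem run_divide {W h q : ℕ} {s : RState} (hb : 0 < s.reg 3) (h22 : s.reg 22 = h)
    (h23 : s.reg 23 = q) (hW : h + q + 1 ≤ W) (hW' : s.reg 3 ≤ W) :
    Run W .divide s (h * 14 + 6) fun s' => (∀ r < 22, s'.reg r = s.reg r) ∧ s'.mem = s.mem ∧
      s'.reg 22 = h % s.reg 3 ∧ s'.reg 23 = q + h / s.reg 3 := by
  induction h using Nat.strong_induction_on generalizing s q with
  | _ h ih =>
    by_cases hlt : h < s.reg 3
    · refine wp_loop_false (by simp [RExpr.Fits, RExpr.eval, h22]; omega) (by simp [RExpr.eval, h22]; omega) ?_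
      refine ⟨by simp [RExpr.cost], fun _ _ => rfl, rfl, ?_, ?_⟩
      · rw [h22, Nat.mod_eq_of_lt hlt]
      · rw [h23, Nat.div_eq_of_lt hlt, add_zero]
    · refine wp_loop_true (by simp [RExpr.Fits, RExpr.eval, h22]; omega) (by simp [RExpr.eval, h22]; omega) ?_
      simp only [wp_seq, wp_assign, RExpr.Fits, RExpr.eval, RExpr.cost, RState.setr_reg, h22, h23]
      refine ⟨by omega, by simp; omega, ?_⟩
      refine (ih (h - s.reg 3) (by omega) (q := q + 1) (by simpa using hb) (by simp) (by simp)
        (by omega) (by simpa using hW')).wp ?_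
      rintro t s' ht ⟨hr, hm, h1, h2⟩
      refine ⟨by omega, fun r h => ?_, by simpa using hm, ?_, ?_⟩
      · rw [hr r h]; simp [h.ne, (h.trans (Nat.lt_succ_self 22)).ne]
      · rw [h1]; simp [Nat.mod_eq_sub_mod (not_lt.1 hlt)]
      · rw [h2]; simp [Nat.div_eq_sub_div hb (not_lt.1 hlt)]; omega

/-- A digit is repeated exactly if its cell is already occupied when it is read. The flag is never
cleared here, so two successive loads accumulate their errors in it. -/
theorem run_load {W n p b k : ℕ} {s : RState} (hb : b < 13) (hk : k < 13)
    (h3 : s.reg 3 = n + n) (hn : 0 < n) (h2 : s.reg 2 = p) (hp : p ≤ W)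
    (hW : s.reg b + (n + n) ≤ W) (hkW : s.reg k + 1 ≤ W) (hbad : s.reg 13 ≤ 1) :
    Run W (.load b k) s (p * (s.reg k * 14 + 30) + n * 22 + 20) fun s' =>
      (∀ r < 20, r ≠ 13 → s'.reg r = s.reg r) ∧
      (∀ a, a < s.reg b ∨ s.reg b + (n + n) ≤ a → s'.mem a = s.mem a) ∧
      s'.reg 13 ≤ 1 ∧
      (s'.reg 13 = 0 ↔ s.reg 13 = 0 ∧ (digitList (n + n) p (s.reg k)).Nodup) ∧
      Arr s'.mem (s.reg b) (n + n) (digitList (n + n) p (s.reg k)).toFinset := by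
  simp only [Run, RProg.load, wp_seq]
  refine (run_fill_zero (by omega) (by omega) (by omega)).wp ?_
  rintro t s1 ht ⟨⟨hr, hm⟩, ha⟩
  rw [h3] at hm ha ht
  simp only [wp_assign, RExpr.Fits, RExpr.eval, RExpr.cost, hr k (by omega)]
  refine ⟨by omega, ?_⟩
  have h21 : ∀ r < 20, r ≠ 21 ∧ r ≠ 22 ∧ r ≠ 23 := by omega
  have key := run_forDown (W := W) (r := 21) (T := s.reg k * 14 + 24) (K := p) (e := .reg 2)
    (s := s1.setr 22 (s.reg k))
    (body := (.seq (.assign 23 (.const 0)) (.seq .divide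
      (.seq (.branch (.mem (.add (.reg b) (.reg 22))) (.assign 13 (.const 1))
        (.store (.add (.reg b) (.reg 22)) (.const 1)))
        (.assign 22 (.reg 23))))))
    -- `w` consists of the digits read so far, and register 22 holds the quotient from which the
    -- remaining `i` digits are obtained.
    (fun i s' => (∀ r < 20, r ≠ 13 → s'.reg r = s.reg r) ∧
      (∀ a, a < s.reg b ∨ s.reg b + (n + n) ≤ a → s'.mem a = s.mem a) ∧
      s'.reg 13 ≤ 1 ∧ s'.reg 22 ≤ s.reg k ∧
      ∃ w, digitList (n + n) p (s.reg k) = w ++ digitList (n + n) i (s'.reg 22) ∧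
        (s'.reg 13 = 0 ↔ s.reg 13 = 0 ∧ w.Nodup) ∧ Arr s'.mem (s.reg b) (n + n) w.toFinset)
    (by omega) hp (by simp [RExpr.eval, hr, h2]) (by simp [RExpr.Fits, hr, h2]; omega) ?_ ?_
  · refine key.wp ?_
    rintro t' s' ht' ⟨hr', hm', h13, -, w, hw, hw', ha'⟩
    refine ⟨?_, hr', hm', h13, ?_⟩
    · simp only [RExpr.cost] at ht'
      rw [show s.reg k * 14 + 24 + 6 = s.reg k * 14 + 30 by ring] at ht'
      omega
    · rw [hw]; simpa [digitList] using ⟨hw', ha'⟩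
  · refine ⟨fun r h _ => ?_, fun a h => ?_, by simpa [hr] using hbad, by simp, [], by simp, ?_, ?_⟩
    · obtain ⟨h1, h2, -⟩ := h21 r h
      simp [h1, h2, hr r (by omega)]
    · simpa using hm a h
    · simp [hr]
    · simpa using ha
  · rintro i s' hi ⟨hr', hm', h13, h22, w, hw, hw', ha'⟩
    have h3' : s'.reg 3 = n + n := by rw [hr' 3 (by omega) (by omega), h3]
    simp only [Run, wp_seq, wp_assign, RExpr.Fits, RExpr.eval, RExpr.cost]
    refine ⟨by omega, ?_⟩
    refine (run_divide (h := s'.reg 22) (q := 0) (by simp [h3', hn]) (by simp) (by simp)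
      (by omega) (by simp [h3']; omega)).wp ?_
    simp only [RState.setr_reg, RState.setr_mem, Nat.reduceEqDiff, if_false, h3',
      zero_add]
    rintro t2 s2 ht2 ⟨hr2, hm2, h2a, h2b⟩
    have hb2 : s2.reg b = s.reg b := by
      obtain ⟨g1, g2, g3⟩ := h21 b (by omega)
      rw [hr2 b (by omega)]; simp [g1, g3, hr' b (by omega) (by omega)]
    have hdW : s'.reg 22 / (n + n) ≤ W := (Nat.div_le_self _ _).trans (by omega)
    have hdig : s'.reg 22 % (n + n) < n + n := Nat.mod_lt _ (by omega)
    have hdig' : s'.reg 22 / (n + n) ≤ s.reg k := (Nat.div_le_self _ _).trans h22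
    have hcell := ha' _ hdig
    have hcW : s'.mem (s.reg b + s'.reg 22 % (n + n)) ≤ W := by rw [hcell]; split <;> omega
    have hreg : ∀ r < 20, r ≠ 13 → s2.reg r = s.reg r := fun r h h' => by
      obtain ⟨g1, g2, g3⟩ := h21 r h
      rw [hr2 r (by omega), if_neg g3, if_neg g1, hr' r h h']
    have h13' : s2.reg 13 = s'.reg 13 := by rw [hr2 13 (by omega)]; simp
    have h21' : s2.reg 21 = i := by rw [hr2 21 (by omega)]; simp
    have hw2 : digitList (n + n) p (s.reg k) = (w ++ [s'.reg 22 % (n + n)]) ++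
        digitList (n + n) i (s'.reg 22 / (n + n)) := by rw [hw]; simp [digitList]
    simp only [wp_branch, wp_assign, wp_store, RExpr.Fits, RExpr.eval, RExpr.cost, hb2, h2a, hm2,
      h2b, RState.setr_reg, RState.setm_reg, RState.setr_mem, Nat.reduceEqDiff, if_false, if_true]
    refine ⟨by omega, fun hne => ?_, fun hz => ?_⟩
    · have hmem : s'.reg 22 % (n + n) ∈ w := by
        by_contra hcon; rw [hcell, if_neg (by simpa using hcon)] at hne; exact hne rfl
      refine ⟨by omega, by omega, by omega, by omega, fun r h h' => ?_, fun a h => ?_, by omega,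
        by omega, w ++ [s'.reg 22 % (n + n)], hw2, ?_, ?_⟩
      · simp [h', (h21 r h).2.1, hreg r h h']
      · exact hm' a h
      · simp [nodup_concat_iff, hmem]
      · rw [toFinset_concat, Finset.insert_eq_of_mem (by simpa using hmem)]
        exact ha'
    · have hmem : s'.reg 22 % (n + n) ∉ w := by
        intro hcon; rw [hcell, if_pos (by simpa using hcon)] at hz; omega
      refine ⟨by omega, by omega, by omega, by omega, by omega, fun r h h' => ?_, fun a h => ?_,
        by omega, by omega, w ++ [s'.reg 22 % (n + n)], hw2, ?_, ?_⟩
      · simp [(h21 r h).2.1, hreg r h h']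
      · have : a ≠ s.reg b + s'.reg 22 % (n + n) := by omega
        simp [this, hm2, hm' a h]
      · rw [h13', hw', nodup_concat_iff]
        tauto
      · have := (show Arr s2.mem (s.reg b) (n + n) w.toFinset by rw [hm2]; exact ha').setm
          (s'.reg 22 % (n + n))
        rw [toFinset_concat]
        exact this

/-! ## Scanning a formula -/

/-- A literal as a number. -/
def litIndex {n : ℕ} (l : Literal n) : ℕ := l.1 + l.1 + if l.2 then 1 else 0

/-- The negation of a literal as a number. -/
def negIndex {n : ℕ} (l : Literal n) : ℕ := l.1 + l.1 + (1 - if l.2 then 1 else 0)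

theorem litIndex_lt {n : ℕ} (l : Literal n) : litIndex l < n + n := by
  have := l.1.2; unfold litIndex; split <;> omega

theorem negIndex_lt {n : ℕ} (l : Literal n) : negIndex l < n + n := by
  have := l.1.2; unfold negIndex; split <;> omega

/-- Add `y` to the set if `x` belongs to it. -/
def implySet (x y : ℕ) (L : Finset ℕ) : Finset ℕ := if x ∈ L then insert y L else L

/-- One step of unit propagation with a single clause. -/
def clauseSet {n : ℕ} (c : Clause2 n) (L : Finset ℕ) : Finset ℕ :=
  if h : c.1 = [] then L else
    implySet (negIndex (c.1.getLast h)) (litIndex (c.1.head h))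
      (implySet (negIndex (c.1.head h)) (litIndex (c.1.getLast h)) L)

/-- Unit propagation with all clauses of a formula, one after the other. -/
def scanSet {n : ℕ} (φ : Formula2 n) (L : Finset ℕ) : Finset ℕ :=
  φ.foldl (fun L c => clauseSet c L) L

theorem subset_implySet (x y : ℕ) (L : Finset ℕ) : L ⊆ implySet x y L := by
  unfold implySet; split
  · exact Finset.subset_insert _ _
  · exact subset_rfl

theorem subset_clauseSet {n : ℕ} (c : Clause2 n) (L : Finset ℕ) : L ⊆ clauseSet c L := by
  unfold clauseSet; split
  · exact subset_rfl
  · exact (subset_implySet _ _ _).trans (subset_implySet _ _ _)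

theorem subset_scanSet {n : ℕ} (φ : Formula2 n) (L : Finset ℕ) : L ⊆ scanSet φ L := by
  unfold scanSet
  induction φ generalizing L with
  | nil => exact subset_rfl
  | cons c φ ih => exact (subset_clauseSet c L).trans (ih _)

theorem scanSet_concat {n : ℕ} (φ : Formula2 n) (c : Clause2 n) (L : Finset ℕ) :
    scanSet (φ ++ [c]) L = clauseSet c (scanSet φ L) := by
  simp [scanSet]

/-- Along an increasing chain the end equals the start only if no link is strict. This allows one
flag, raised at any enlargement, to decide whether a whole scan was the identity. -/
theorem eq_iff_of_chain {L A B : Finset ℕ} (h1 : L ⊆ A) (h2 : A ⊆ B) :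
    B = L ↔ A = L ∧ B = A := by
  constructor
  · rintro rfl
    have := h2.antisymm h1
    exact ⟨this, this.symm⟩
  · rintro ⟨rfl, rfl⟩; rfl

/-- The cells from address `a` on hold the list `w`. -/
def Holds (mem : ℕ → ℕ) : ℕ → List ℕ → Prop
  | _, [] => True
  | a, x :: w => mem a = x ∧ Holds mem (a + 1) w

theorem holds_append {mem : ℕ → ℕ} {a : ℕ} {v w : List ℕ} :
    Holds mem a (v ++ w) ↔ Holds mem a v ∧ Holds mem (a + v.length) w := by
  induction v generalizing a with
  | nil => simp [Holds]
  | cons x v ih => simp [Holds, ih, and_assoc, Nat.add_assoc, Nat.add_comm 1]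

theorem Holds.congr {mem mem' : ℕ → ℕ} {a : ℕ} {w : List ℕ} (h : Holds mem a w)
    (h' : ∀ i, a ≤ i → i < a + w.length → mem' i = mem i) : Holds mem' a w := by
  induction w generalizing a with
  | nil => trivial
  | cons x w ih =>
    refine ⟨by rw [h' a le_rfl (by simp), h.1], ih h.2 fun i h1 h2 => h' i (by omega) ?_⟩
    simp only [List.length_cons]; omega

open M2SAT in
-- With `z = mem a` literals of two words each, the first literal is found from the front and the
-- last one at offset `2z`. For `z = 1` they coincide, so the program treats clauses of one and of
-- two literals uniformly.
theorem holds_encClause {n : ℕ} {c : Clause2 n} {mem : ℕ → ℕ} {a : ℕ} (hc : c.1 ≠ [])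
    (h : Holds mem a (encClause c)) :
    mem (a + 1) = (c.1.head hc).1 ∧ mem (a + 2) = (if (c.1.head hc).2 then 1 else 0) ∧
    mem (a + mem a + mem a - 1) = (c.1.getLast hc).1 ∧
    mem (a + mem a + mem a) = (if (c.1.getLast hc).2 then 1 else 0) ∧
    1 ≤ mem a ∧ mem a ≤ 2 ∧ (encClause c).length = mem a + mem a + 1 := by
  obtain ⟨c, hlen⟩ := c
  match c, hlen, hc with
  | [l], _, _ =>
    simp only [encClause, encLiteral, List.flatMap_cons, List.flatMap_nil, List.append_nil, Holds,
      List.length_cons, List.length_nil] at h ⊢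
    obtain ⟨h0, h1, h2, -⟩ := h
    simp [h0, h1, h2]
    exact ⟨rfl, rfl⟩
  | [l, l'], _, _ =>
    simp only [encClause, encLiteral, List.flatMap_cons, List.flatMap_nil, List.append_nil, Holds,
      List.length_cons, List.length_nil, List.cons_append, List.nil_append] at h ⊢
    obtain ⟨h0, h1, h2, h3, h4, -⟩ := h
    simp [h0, h1, h2, h3, h4]
    rfl

namespace RProg

/-- If the literal in register `x` is in the array at `b`, put the literal in register `y` there,
and report a change in register `20`. -/
def imply (b x y : ℕ) : RProg :=
  .branch (.mem (.add (.reg b) (.reg x)))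
    (.branch (.mem (.add (.reg b) (.reg y))) .skip
      (.seq (.store (.add (.reg b) (.reg y)) (.const 1)) (.assign 20 (.const 1))))
    .skip

/-- Read the nonempty clause at the address in register `12`, which has `z` literals for the
content `z` of register `25`: the first literal and its negation go to the registers `26` and
`27`, the last literal and its negation to the registers `28` and `29`, and register `12` moves
to the end of the clause. -/
def readClause : RProg :=
  .seq (.assign 26 (.add (.add (.mem (.add (.reg 12) (.const 1)))
      (.mem (.add (.reg 12) (.const 1)))) (.mem (.add (.reg 12) (.const 2)))))
  (.seq (.assign 27 (.add (.add (.mem (.add (.reg 12) (.const 1)))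
      (.mem (.add (.reg 12) (.const 1))))
      (.sub (.const 1) (.mem (.add (.reg 12) (.const 2))))))
  (.seq (.assign 12 (.add (.add (.reg 12) (.reg 25)) (.reg 25)))
  (.seq (.assign 28 (.add (.add (.mem (.sub (.reg 12) (.const 1)))
      (.mem (.sub (.reg 12) (.const 1)))) (.mem (.reg 12))))
  (.seq (.assign 29 (.add (.add (.mem (.sub (.reg 12) (.const 1)))
      (.mem (.sub (.reg 12) (.const 1)))) (.sub (.const 1) (.mem (.reg 12)))))
  (.assign 12 (.add (.reg 12) (.const 1)))))))

/-- Propagate with all clauses of the formula at the address in register `9`. Register `20` tells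
whether the set at `b` has changed, the flag in register `13` is set if there is an empty clause,
and register `12` is the address after the formula. -/
def scan (b : ℕ) : RProg :=
  .seq (.assign 20 (.const 0)) (.seq (.assign 12 (.add (.reg 9) (.const 1)))
    (.forDown 24 (.mem (.reg 9))
      (.seq (.assign 25 (.mem (.reg 12)))
        (.branch (.reg 25) (.seq .readClause (.seq (.imply b 27 28) (.imply b 29 26)))
          (.seq (.assign 13 (.const 1)) (.assign 12 (.add (.reg 12) (.const 1))))))))

end RProg

/-! ### Running time and effect of one propagation scan. -/

theorem run_imply {W m b x y : ℕ} {s : RState} {L : Finset ℕ} (h1 : 1 ≤ W)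
    (hW : s.reg b + m ≤ W) (hx : s.reg x < m) (hy : s.reg y < m) (h20 : s.reg 20 ≤ 1)
    (hL : Arr s.mem (s.reg b) m L) :
    Run W (.imply b x y) s 20 fun s' => (∀ r, r ≠ 20 → s'.reg r = s.reg r) ∧
      (∀ a, a < s.reg b ∨ s.reg b + m ≤ a → s'.mem a = s.mem a) ∧
      Arr s'.mem (s.reg b) m (implySet (s.reg x) (s.reg y) L) ∧ s'.reg 20 ≤ 1 ∧
      (s'.reg 20 = 0 ↔ s.reg 20 = 0 ∧ implySet (s.reg x) (s.reg y) L = L) := by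
  have hlx := hL.le_one hx
  have hly := hL.le_one hy
  simp only [Run, RProg.imply, wp_branch, wp_seq, wp_skip, wp_store, wp_assign, RExpr.Fits,
    RExpr.eval, RExpr.cost]
  refine ⟨by omega, fun hnx => ⟨by omega, fun hny => ?_, fun hzy => ?_⟩, fun hzx => ?_⟩
  · have hxL : s.reg x ∈ L := not_not.1 fun h => hnx ((hL.eq_zero_iff hx).2 h)
    have hyL : s.reg y ∈ L := not_not.1 fun h => hny ((hL.eq_zero_iff hy).2 h)
    have : implySet (s.reg x) (s.reg y) L = L := by simp [implySet, hyL]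
    rw [this]
    exact ⟨by omega, fun _ _ => trivial, fun _ _ => trivial, hL, h20, by simp⟩
  · have hxL : s.reg x ∈ L := not_not.1 fun h => hnx ((hL.eq_zero_iff hx).2 h)
    have hyL : s.reg y ∉ L := (hL.eq_zero_iff hy).1 hzy
    have : implySet (s.reg x) (s.reg y) L = insert (s.reg y) L := by simp [implySet, hxL]
    rw [this]
    refine ⟨by omega, by omega, by omega, by omega, fun r h => by simp [h], fun a h => ?_,
      hL.setm (s.reg y), by simp, ?_⟩
    · have : a ≠ s.reg b + s.reg y := by omega
      simp [this]
    · simp [hyL]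
  · have hxL : s.reg x ∉ L := (hL.eq_zero_iff hx).1 hzx
    have : implySet (s.reg x) (s.reg y) L = L := by simp [implySet, hxL]
    rw [this]
    exact ⟨by omega, fun _ _ => trivial, fun _ _ => trivial, hL, h20, by simp⟩

open M2SAT in
theorem run_readClause {W n : ℕ} {s : RState} {c : Clause2 n} (hc : c.1 ≠ [])
    (h : Holds s.mem (s.reg 12) (encClause c)) (h25 : s.reg 25 = s.mem (s.reg 12))
    (hW : s.reg 12 + (encClause c).length ≤ W) (hn : n + n + 2 ≤ W) :
    Run W .readClause s 70 fun s' =>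
      (∀ r, r ≠ 12 → r ≠ 26 → r ≠ 27 → r ≠ 28 → r ≠ 29 → s'.reg r = s.reg r) ∧ s'.mem = s.mem ∧
      s'.reg 12 = s.reg 12 + (encClause c).length ∧
      s'.reg 26 = litIndex (c.1.head hc) ∧ s'.reg 27 = negIndex (c.1.head hc) ∧
      s'.reg 28 = litIndex (c.1.getLast hc) ∧ s'.reg 29 = negIndex (c.1.getLast hc) := by
  obtain ⟨h1, h2, h3, h4, h5, h6, h7⟩ := holds_encClause hc h
  have hv1 := (c.1.head hc).1.2
  have hv2 := (c.1.getLast hc).1.2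
  have hs1 : (if (c.1.head hc).2 then 1 else 0) ≤ 1 := by split <;> simp
  have hs2 : (if (c.1.getLast hc).2 then 1 else 0) ≤ 1 := by split <;> simp
  simp only [Run, RProg.readClause, wp_seq, wp_assign, RExpr.Fits, RExpr.eval, RExpr.cost,
    RState.setr_reg, RState.setr_mem, Nat.reduceEqDiff, if_true, if_false, h25, h1, h2, h3, h4]
  refine ⟨by omega, by omega, by omega, by omega, by omega, by omega, by omega,
    fun r g1 g2 g3 g4 g5 => by simp [g1, g2, g3, g4, g5], trivial, ?_, rfl, rfl, rfl, rfl⟩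
  omega

theorem clauseSet_of_ne {n : ℕ} {c : Clause2 n} (hc : c.1 ≠ []) (L : Finset ℕ) :
    clauseSet c L = implySet (negIndex (c.1.getLast hc)) (litIndex (c.1.head hc))
      (implySet (negIndex (c.1.head hc)) (litIndex (c.1.getLast hc)) L) := by
  simp [clauseSet, hc]

open M2SAT in
theorem run_scan {W n b : ℕ} {s : RState} {φ : Formula2 n} {L : Finset ℕ} (hb : b < 9)
    (hφ : Holds s.mem (s.reg 9) (encFormula φ))
    (hdis : s.reg 9 + (encFormula φ).length ≤ s.reg b) (hW : s.reg b + (n + n) + 2 ≤ W)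
    (hφW : φ.length ≤ W) (hL : Arr s.mem (s.reg b) (n + n) L) (h13 : s.reg 13 ≤ 1) :
    Run W (.scan b) s (φ.length * 130 + 20) fun s' =>
      (∀ r < 20, r ≠ 12 → r ≠ 13 → s'.reg r = s.reg r) ∧
      (∀ a, a < s.reg b ∨ s.reg b + (n + n) ≤ a → s'.mem a = s.mem a) ∧
      s'.reg 12 = s.reg 9 + (encFormula φ).length ∧
      s'.reg 13 ≤ 1 ∧ (s'.reg 13 = 0 ↔ s.reg 13 = 0 ∧ ∀ c ∈ φ, c.1 ≠ []) ∧
      s'.reg 20 ≤ 1 ∧ (s'.reg 20 = 0 ↔ scanSet φ L = L) ∧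
      Arr s'.mem (s.reg b) (n + n) (scanSet φ L) := by
  have hlen : (encFormula φ).length = 1 + (φ.flatMap encClause).length := by
    simp [encFormula, Nat.add_comm]
  have h0 : s.mem (s.reg 9) = φ.length := hφ.1
  have hφ' : Holds s.mem (s.reg 9 + 1) (φ.flatMap encClause) := hφ.2
  have hb' : b ≠ 12 ∧ b ≠ 20 ∧ b ≠ 24 ∧ b ≠ 25 := by omega
  simp only [Run, RProg.scan, wp_seq, wp_assign, RExpr.Fits, RExpr.eval, RExpr.cost,
    RState.setr_reg, Nat.reduceEqDiff, if_false]
  refine ⟨by omega, by omega, ?_⟩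
  have key := run_forDown (W := W) (r := 24) (T := 124) (K := φ.length) (e := .mem (.reg 9))
    (s := (s.setr 20 0).setr 12 (s.reg 9 + 1))
    (body := (.seq (.assign 25 (.mem (.reg 12)))
        (.branch (.reg 25) (.seq .readClause (.seq (.imply b 27 28) (.imply b 29 26)))
          (.seq (.assign 13 (.const 1)) (.assign 12 (.add (.reg 12) (.const 1)))))))
    -- `pre` has been scanned and `suf` remains. The encoding is tracked in the initial memory,
    -- since the formula lies entirely below the array being modified.
    (fun i s' => (∀ r < 20, r ≠ 12 → r ≠ 13 → s'.reg r = s.reg r) ∧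
      (∀ a, a < s.reg b ∨ s.reg b + (n + n) ≤ a → s'.mem a = s.mem a) ∧
      s'.reg 13 ≤ 1 ∧ s'.reg 20 ≤ 1 ∧
      ∃ pre suf, φ = pre ++ suf ∧ suf.length = i ∧
        s'.reg 12 + (suf.flatMap encClause).length = s.reg 9 + (encFormula φ).length ∧
        Holds s.mem (s'.reg 12) (suf.flatMap encClause) ∧
        (s'.reg 13 = 0 ↔ s.reg 13 = 0 ∧ ∀ c ∈ pre, c.1 ≠ []) ∧
        (s'.reg 20 = 0 ↔ scanSet pre L = L) ∧
        Arr s'.mem (s.reg b) (n + n) (scanSet pre L))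
    (by omega) hφW (by simp [RExpr.eval, h0]) (by simp [RExpr.Fits, RExpr.eval, h0]; omega) ?_ ?_
  · refine key.wp ?_
    rintro t s' ht ⟨hr, hm, h13', h20', pre, suf, hφe, hsuf, h12, -, hbad, hch, ha⟩
    obtain rfl := List.length_eq_zero_iff.1 hsuf
    rw [List.append_nil] at hφe
    subst hφe
    refine ⟨?_, hr, hm, by simpa using h12, h13', hbad, h20', hch, ha⟩
    simp only [RExpr.cost] at ht; omega
  · refine ⟨fun r h g _ => ?_, fun _ _ => rfl, by simpa using h13, by simp, [], φ, rfl, rfl, ?_, ?_,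
      by simp, by simp [scanSet], by simpa [scanSet] using hL⟩
    · have : r ≠ 24 ∧ r ≠ 20 := by omega
      simp [this, g]
    · simp [hlen]; omega
    · simpa using hφ'
  · rintro i s' hi ⟨hr, hm, h13', h20', pre, suf, hφe, hsuf, h12, hh, hbad, hch, ha⟩
    obtain ⟨c, suf, rfl⟩ := List.exists_cons_of_length_eq_add_one hsuf
    rw [List.flatMap_cons, List.length_append] at h12
    rw [List.flatMap_cons, holds_append] at hh
    have hclen : 1 ≤ (encClause c).length := by simp [encClause]
    have hmem : ∀ a, a < s.reg b → s'.mem a = s.mem a := fun a h => hm a (.inl h)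
    have hcl : s'.mem (s'.reg 12) = c.1.length := by rw [hmem _ (by omega)]; exact hh.1.1
    have hc2 := c.2
    have hφe' : φ = (pre ++ [c]) ++ suf := by simp [hφe]
    simp only [Run, wp_seq, wp_branch, wp_assign, RExpr.Fits, RExpr.eval, RExpr.cost,
      RState.setr_reg, RState.setr_mem, Nat.reduceEqDiff, if_true, if_false, hcl]
    refine ⟨by omega, by omega, fun hne => ?_, fun hz => ?_⟩
    · have hc : c.1 ≠ [] := fun h => hne (by simp [h])
      refine (run_readClause (n := n) (c := c) hc ?_ ?_ ?_ ?_).wp ?_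
      · refine Holds.congr (by simpa using hh.1) fun a h1 h2 => hmem a ?_
        simp at h2; omega
      · simp [hcl]
      · simp; omega
      · omega
      simp only [RState.setr_reg, RState.setr_mem, Nat.reduceEqDiff, if_false]
      rintro t1 s1 ht1 ⟨hr1, hm1, g12, g26, g27, g28, g29⟩
      have hb1 : s1.reg b = s.reg b := by
        rw [hr1 b (by omega) (by omega) (by omega) (by omega) (by omega), if_neg hb'.2.2.2,
          if_neg hb'.2.2.1, hr b (by omega) (by omega) (by omega)]
      have g20 : s1.reg 20 = s'.reg 20 := by rw [hr1 20] <;> simp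
      refine (run_imply (W := W) (m := n + n) (L := scanSet pre L) (by omega)
        (by omega) (by rw [g27]; exact negIndex_lt _) (by rw [g28]; exact litIndex_lt _)
        (by omega) (by rw [hb1, hm1]; exact ha)).wp ?_
      rintro t2 s2 ht2 ⟨hr2, hm2, ha2, h20a, h20b⟩
      rw [hb1, g27, g28] at ha2
      rw [g27, g28, g20, hch] at h20b
      rw [hb1, hm1] at hm2
      refine (run_imply (W := W) (m := n + n)
        (L := implySet (negIndex (c.1.head hc)) (litIndex (c.1.getLast hc)) (scanSet pre L))
        (by omega) (by rw [hr2 b (by omega)]; omega)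
        (by rw [hr2 29 (by omega), g29]; exact negIndex_lt _)
        (by rw [hr2 26 (by omega), g26]; exact litIndex_lt _)
        h20a (by rw [hr2 b (by omega), hb1]; exact ha2)).wp ?_
      rintro t3 s3 ht3 ⟨hr3, hm3, ha3, h20c, h20d⟩
      rw [hr2 b (by omega), hb1, hr2 29 (by omega), g29, hr2 26 (by omega), g26,
        ← clauseSet_of_ne hc, ← scanSet_concat] at ha3
      rw [hr2 29 (by omega), g29, hr2 26 (by omega), g26, ← clauseSet_of_ne hc,
        ← scanSet_concat, h20b] at h20d
      rw [hr2 b (by omega), hb1] at hm3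
      have hfin : ∀ r, r ≠ 12 → r ≠ 20 → r ≠ 24 → r ≠ 25 → r ≠ 26 → r ≠ 27 → r ≠ 28 → r ≠ 29 →
          s3.reg r = s'.reg r := fun r k1 k2 k3 k4 k5 k6 k7 k8 => by
        rw [hr3 r k2, hr2 r k2, hr1 r k1 k5 k6 k7 k8, if_neg k4, if_neg k3]
      have f13 : s3.reg 13 = s'.reg 13 := hfin 13 (by omega) (by omega) (by omega) (by omega)
        (by omega) (by omega) (by omega) (by omega)
      have f12 : s3.reg 12 = s'.reg 12 + (encClause c).length := by
        rw [hr3 12 (by omega), hr2 12 (by omega), g12]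
      have f24 : s3.reg 24 = i := by
        rw [hr3 24 (by omega), hr2 24 (by omega), hr1 24] <;> simp
      refine ⟨by omega, f24, fun r h k1 k2 => ?_, fun a h => ?_, by omega, h20c, pre ++ [c], suf,
        hφe', by simpa using hsuf, by omega, ?_, ?_, ?_, ha3⟩
      · rw [hfin r k1 (by omega) (by omega) (by omega) (by omega) (by omega) (by omega) (by omega),
          hr r h k1 k2]
      · rw [hm3 a h, hm2 a h, hm a h]
      · rw [f12]; exact hh.2
      · rw [f13, hbad]
        constructor
        · rintro ⟨k1, k2⟩
          refine ⟨k1, fun d hd => ?_⟩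
          rcases List.mem_append.1 hd with hd | hd
          · exact k2 d hd
          · rw [List.mem_singleton.1 hd]; exact hc
        · exact fun k => ⟨k.1, fun d hd => k.2 d (List.mem_append_left _ hd)⟩
      -- The flag stays `0` iff none of the three successive enlargements (the earlier clauses and
      -- the two implications of `c`) adds a literal; by monotonicity this means that the final set
      -- is still `L`.
      · rw [h20d, scanSet_concat, clauseSet_of_ne hc]
        constructor
        · rintro ⟨⟨k1, k2⟩, k3⟩
          rw [k3, k2, k1]
        · intro k
          have k1 := (eq_iff_of_chain (subset_scanSet pre L) ((subset_implySet _ _ _).trans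
            (subset_implySet _ _ _))).1 k
          have k2 := (eq_iff_of_chain (subset_implySet _ _ _) (subset_implySet _ _ _)).1 k1.2
          exact ⟨⟨k1.1, k2.1⟩, k2.2⟩
    · have hc : c.1 = [] := List.length_eq_zero_iff.1 hz
      have hce : (encClause c).length = 1 := by simp [encClause, hc]
      have hset : scanSet (pre ++ [c]) L = scanSet pre L := by
        rw [scanSet_concat]; simp [clauseSet, hc]
      refine ⟨by omega, by omega, by omega, trivial, fun r h k1 k2 => ?_, hm, by omega,
        h20', pre ++ [c], suf, hφe', by simpa using hsuf, by omega, ?_, ?_, ?_, ?_⟩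
      · have : r ≠ 24 ∧ r ≠ 25 := by omega
        simp [k1, k2, this, hr r h k1 k2]
      · rw [← hce]; exact hh.2
      · exact iff_of_false (by simp) fun h => h.2 c (by simp) hc
      · rw [hset]; exact hch
      · rw [hset]; exact ha

/-! ## Conflicts and unassigned variables -/

/-- A variable and its negation both belong to the set. -/
def Conflict (n : ℕ) (L : Finset ℕ) : Prop := ∃ v < n, v + v ∈ L ∧ v + v + 1 ∈ L

/-- Each variable or its negation belongs to the set. -/
def Full (n : ℕ) (L : Finset ℕ) : Prop := ∀ v < n, v + v ∈ L ∨ v + v + 1 ∈ L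

/-- The sets after branching from `L` on an unassigned variable, if there is one. -/
def Split (n : ℕ) (L A B : Finset ℕ) : Prop :=
  (Full n L ∧ A = L ∧ B = L) ∨
    ∃ v < n, v + v ∉ L ∧ v + v + 1 ∉ L ∧ A = insert (v + v) L ∧ B = insert (v + v + 1) L

namespace RProg

/-- Count the conflicts of the array at `b` in register `21`. -/
def check (b : ℕ) : RProg :=
  .seq (.assign 21 (.const 0)) (.forDown 30 (.reg 1) (.assign 21 (.add (.reg 21)
    (.sub (.add (.mem (.add (.reg b) (.add (.reg 30) (.reg 30))))
      (.mem (.add (.add (.reg b) (.add (.reg 30) (.reg 30))) (.const 1)))) (.const 1)))))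

/-- Put the index of an unassigned variable into register `22`, or the content of register `3` if
there is none. -/
def pick (b : ℕ) : RProg :=
  .seq (.assign 22 (.reg 3)) (.forDown 30 (.reg 1)
    (.branch (.add (.mem (.add (.reg b) (.add (.reg 30) (.reg 30))))
      (.mem (.add (.add (.reg b) (.add (.reg 30) (.reg 30))) (.const 1)))) .skip
      (.assign 22 (.add (.reg 30) (.reg 30)))))

/-- Replace the array at `dst` by the one at `src` and branch on an unassigned variable. -/
def commit (src dst : ℕ) : RProg :=
  .seq (.copy src dst 3) (.seq (.pick src)
    (.branch (.sub (.reg 3) (.reg 22))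
      (.seq (.store (.add (.reg src) (.reg 22)) (.const 1))
        (.store (.add (.add (.reg dst) (.reg 22)) (.const 1)) (.const 1)))
      .skip))

end RProg

/-- The cells are `0` or `1`, so the truncated difference of their sum and `1` is `1` exactly at a
conflicting variable. -/
theorem run_check {W n b : ℕ} {s : RState} {L : Finset ℕ} (hb : b < 20) (h1 : s.reg 1 = n)
    (hW : s.reg b + (n + n) + 2 ≤ W) (hL : Arr s.mem (s.reg b) (n + n) L) :
    Run W (.check b) s (n * 26 + 6) fun s' => (∀ r < 21, s'.reg r = s.reg r) ∧ s'.mem = s.mem ∧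
      s'.reg 21 ≤ n ∧ (s'.reg 21 = 0 ↔ ¬ Conflict n L) := by
  simp only [Run, RProg.check, wp_seq, wp_assign, RExpr.Fits, RExpr.eval, RExpr.cost]
  refine ⟨by omega, ?_⟩
  have key := run_forDown (W := W) (r := 30) (T := 20) (K := n) (e := .reg 1) (s := s.setr 21 0)
    (body := (.assign 21 (.add (.reg 21)
      (.sub (.add (.mem (.add (.reg b) (.add (.reg 30) (.reg 30))))
      (.mem (.add (.add (.reg b) (.add (.reg 30) (.reg 30))) (.const 1)))) (.const 1)))))
    (fun k s' => (∀ r < 21, s'.reg r = s.reg r) ∧ s'.mem = s.mem ∧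
      s'.reg 21 + k ≤ n ∧ (s'.reg 21 = 0 ↔ ∀ v < n, k ≤ v → ¬ (v + v ∈ L ∧ v + v + 1 ∈ L)))
    (by omega) (by omega) (by simp [RExpr.eval, h1]) (by simp [RExpr.Fits, h1]; omega) ?_ ?_
  · refine key.wp ?_
    rintro t s' ht ⟨hr, hm, hle, hiff⟩
    refine ⟨by simp only [RExpr.cost] at ht; omega, hr, hm, hle, ?_⟩
    rw [hiff]; simp [Conflict]
  · refine ⟨fun r h => ?_, rfl, by simp, ?_⟩
    · have : r ≠ 30 ∧ r ≠ 21 := by omega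
      simp [this]
    · simp; intro v h1 h2; omega
  · rintro k s' hk ⟨hr, hm, hle, hiff⟩
    have hb30 : b ≠ 30 := by omega
    have c1 := hL.le_one (e := k + k) (by omega)
    have c2 := hL.le_one (e := k + k + 1) (by omega)
    have d1 := hL.eq_zero_iff (e := k + k) (by omega)
    have d2 := hL.eq_zero_iff (e := k + k + 1) (by omega)
    rw [← add_assoc] at c2 d2
    simp only [Run, wp_assign, RExpr.Fits, RExpr.eval, RExpr.cost, RState.setr_reg,
      RState.setr_mem, if_true, if_false, hb30, hr b (by omega), hm, Nat.reduceEqDiff]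
    refine ⟨by omega, by omega, trivial, fun r h => ?_, trivial, by omega, ?_⟩
    · have : r ≠ 30 ∧ r ≠ 21 := by omega
      simp [this, hr r h]
    · rw [Nat.add_eq_zero_iff, hiff]
      constructor
      · rintro ⟨h1, h2⟩ v hv hkv ⟨g1, g2⟩
        rcases Nat.eq_or_lt_of_le hkv with rfl | hlt
        · have : ¬ s.mem (s.reg b + (k + k)) = 0 := fun h => d1.1 h g1
          have : ¬ s.mem (s.reg b + (k + k) + 1) = 0 := fun h => d2.1 h g2
          omega
        · exact h1 v hv hlt ⟨g1, g2⟩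
      · refine fun h => ⟨fun v hv hkv => h v hv (by omega), ?_⟩
        by_cases g1 : k + k ∈ L
        · have g2 : k + k + 1 ∉ L := fun g2 => h k hk le_rfl ⟨g1, g2⟩
          have := d2.2 g2
          omega
        · have := d1.2 g1
          omega

/-- The value `2n` serves as a sentinel: every index `2v` of a variable is smaller, so a later
subtraction tells whether an unassigned variable was found. -/
theorem run_pick {W n b : ℕ} {s : RState} {L : Finset ℕ} (hb : b < 20) (h1 : s.reg 1 = n)
    (h3 : s.reg 3 = n + n)
    (hW : s.reg b + (n + n) + 2 ≤ W) (hL : Arr s.mem (s.reg b) (n + n) L) :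
    Run W (.pick b) s (n * 26 + 6) fun s' => (∀ r < 21, s'.reg r = s.reg r) ∧ s'.mem = s.mem ∧
      ((s'.reg 22 = n + n ∧ Full n L) ∨
        ∃ v < n, s'.reg 22 = v + v ∧ v + v ∉ L ∧ v + v + 1 ∉ L) := by
  simp only [Run, RProg.pick, wp_seq, wp_assign, RExpr.Fits, RExpr.eval, RExpr.cost, h3]
  refine ⟨by omega, ?_⟩
  have key := run_forDown (W := W) (r := 30) (T := 20) (K := n) (e := .reg 1)
    (s := s.setr 22 (n + n))
    (body := (.branch (.add (.mem (.add (.reg b) (.add (.reg 30) (.reg 30))))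
      (.mem (.add (.add (.reg b) (.add (.reg 30) (.reg 30))) (.const 1)))) .skip
      (.assign 22 (.add (.reg 30) (.reg 30)))))
    (fun k s' => (∀ r < 21, s'.reg r = s.reg r) ∧ s'.mem = s.mem ∧
      ((s'.reg 22 = n + n ∧ ∀ v < n, k ≤ v → v + v ∈ L ∨ v + v + 1 ∈ L) ∨
        ∃ v < n, s'.reg 22 = v + v ∧ v + v ∉ L ∧ v + v + 1 ∉ L))
    (by omega) (by omega) (by simp [RExpr.eval, h1]) (by simp [RExpr.Fits, h1]; omega) ?_ ?_
  · refine key.wp ?_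
    rintro t s' ht ⟨hr, hm, hiff⟩
    refine ⟨by simp only [RExpr.cost] at ht; omega, hr, hm, ?_⟩
    simpa [Full] using hiff
  · refine ⟨fun r h => ?_, rfl, .inl ⟨by simp, fun v h1 h2 => by omega⟩⟩
    have : r ≠ 30 ∧ r ≠ 22 := by omega
    simp [this]
  · rintro k s' hk ⟨hr, hm, hor⟩
    have hb30 : b ≠ 30 := by omega
    have c1 := hL.le_one (e := k + k) (by omega)
    have c2 := hL.le_one (e := k + k + 1) (by omega)
    have d1 := hL.eq_zero_iff (e := k + k) (by omega)
    have d2 := hL.eq_zero_iff (e := k + k + 1) (by omega)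
    rw [← add_assoc] at c2 d2
    simp only [Run, wp_assign, wp_branch, wp_skip, RExpr.Fits, RExpr.eval, RExpr.cost,
      RState.setr_reg, RState.setr_mem, if_true, if_false, hb30, hr b (by omega), hm,
      Nat.reduceEqDiff]
    refine ⟨by omega, fun hne => ?_, fun hz => ?_⟩
    · refine ⟨by omega, trivial, fun r h => ?_, trivial, hor.imp ?_ id⟩
      · have : r ≠ 30 := by omega
        simp [this, hr r h]
      · refine fun h => ⟨h.1, fun v hv hkv => ?_⟩
        rcases Nat.eq_or_lt_of_le hkv with rfl | hlt
        · by_contra hcon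
          push Not at hcon
          have := d1.2 hcon.1
          have := d2.2 hcon.2
          omega
        · exact h.2 v hv hlt
    · refine ⟨by omega, by omega, trivial, fun r h => ?_, trivial, .inr ⟨k, hk, rfl,
        d1.1 (by omega), d2.1 (by omega)⟩⟩
      have : r ≠ 30 ∧ r ≠ 22 := by omega
      simp [this, hr r h]

/-- The set at `dst` is discarded: both arrays become copies of the set at `src` before they receive
opposite literals. If every variable is assigned, they remain equal copies. -/
theorem run_commit {W n src dst : ℕ} {s : RState} {L : Finset ℕ} (hs : src < 20) (hd : dst < 20)
    (h1 : s.reg 1 = n) (h3 : s.reg 3 = n + n)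
    (hW : s.reg src + (n + n) + 2 ≤ W) (hW' : s.reg dst + (n + n) + 2 ≤ W)
    (hdis : s.reg src + (n + n) ≤ s.reg dst ∨ s.reg dst + (n + n) ≤ s.reg src)
    (hL : Arr s.mem (s.reg src) (n + n) L) :
    Run W (.commit src dst) s (n * 54 + 30) fun s' => (∀ r < 21, s'.reg r = s.reg r) ∧
      (∀ a, a < s.reg src ∨ s.reg src + (n + n) ≤ a → a < s.reg dst ∨ s.reg dst + (n + n) ≤ a →
        s'.mem a = s.mem a) ∧
      ∃ A B, Split n L A B ∧ Arr s'.mem (s.reg src) (n + n) A ∧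
        Arr s'.mem (s.reg dst) (n + n) B := by
  simp only [Run, RProg.commit, wp_seq]
  refine (run_copy (len := 3) (L := L) (by omega) (by omega) (by omega) (by omega) (by omega)
    (by omega) (by rw [h3]; exact hL)).wp ?_
  rintro t1 s1 ht1 ⟨⟨hr1, hm1⟩, ha1⟩
  rw [h3] at ha1 hm1 ht1
  have hA : Arr s1.mem (s.reg src) (n + n) L := hL.congr fun a _ _ => hm1 a (by omega)
  refine (run_pick (n := n) (L := L) hs (by rw [hr1 1 (by omega), h1])
    (by rw [hr1 3 (by omega), h3]) (by rw [hr1 src (by omega)]; exact hW)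
    (by rw [hr1 src (by omega)]; exact hA)).wp ?_
  rintro t2 s2 ht2 ⟨hr2, hm2, hor⟩
  have hreg : ∀ r < 21, s2.reg r = s.reg r := fun r h => by rw [hr2 r h, hr1 r (by omega)]
  simp only [wp_branch, wp_seq, wp_skip, wp_store, RExpr.Fits, RExpr.eval, RExpr.cost,
    RState.setm_reg, hreg 3 (by omega), h3, hreg src (by omega), hreg dst (by omega)]
  rw [← hm2] at hA ha1
  rcases hor with ⟨h22, hfull⟩ | ⟨v, hv, h22, hv1, hv2⟩
  · refine ⟨by omega, fun h => by omega, fun _ => ⟨by omega, hreg, fun a h h' => ?_, L, L,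
      .inl ⟨hfull, rfl, rfl⟩, hA, ha1⟩⟩
    rw [hm2, hm1 a h']
  · refine ⟨by omega, fun _ => ⟨by omega, by omega, by omega, by omega, by omega, hreg,
      fun a h h' => ?_, insert (v + v) L, insert (v + v + 1) L,
      .inr ⟨v, hv, hv1, hv2, rfl, rfl⟩, ?_, ?_⟩, fun h => by omega⟩
    · have g1 : a ≠ s.reg src + s2.reg 22 := by omega
      have g2 : a ≠ s.reg dst + s2.reg 22 + 1 := by omega
      simp only [RState.setm_mem, g1, g2, if_false]
      rw [hm2, hm1 a h']
    · rw [h22]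
      refine (hA.setm (v + v)).congr fun a g1 g2 => ?_
      have : a ≠ s.reg dst + (v + v) + 1 := by omega
      simp [this]
    · rw [h22, add_assoc (s.reg dst)]
      refine Arr.setm (ha1.congr fun a g1 g2 => ?_) (v + v + 1)
      have : a ≠ s.reg src + (v + v) := by omega
      simp [this]

/-! ## Correctness of the propagation algorithm for 2-SAT -/

theorem exists_litIndex {n e : ℕ} (he : e < n + n) : ∃ l : Literal n, litIndex l = e := by
  refine ⟨(⟨e / 2, by omega⟩, decide (e % 2 = 1)), ?_⟩
  simp only [litIndex, decide_eq_true_eq]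
  split <;> omega

theorem litIndex_injective {n : ℕ} : Function.Injective (litIndex (n := n)) := by
  rintro ⟨v, s⟩ ⟨w, t⟩ h
  simp only [litIndex] at h
  cases s <;> cases t <;> simp at h <;> first | omega | skip
  all_goals
    rw [Prod.mk.injEq]
    exact ⟨Fin.ext (by omega), rfl⟩

theorem negIndex_eq {n : ℕ} (l : Literal n) : negIndex l = litIndex (l.1, !l.2) := by
  obtain ⟨v, s⟩ := l
  cases s <;> simp [negIndex, litIndex]

/-- The assignment `f` makes all literals of `L` true. -/
def Agrees {n : ℕ} (f : Fin n → Bool) (L : Finset ℕ) : Prop :=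
  ∀ l : Literal n, litIndex l ∈ L → f l.1 = l.2

theorem Agrees.mono {n : ℕ} {f : Fin n → Bool} {L M : Finset ℕ} (h : Agrees f M) (hLM : L ⊆ M) :
    Agrees f L := fun l hl => h l (hLM hl)

theorem Agrees.not_conflict {n : ℕ} {f : Fin n → Bool} {L : Finset ℕ} (h : Agrees f L) :
    ¬ Conflict n L := by
  rintro ⟨v, hv, h1, h2⟩
  have g1 := h (⟨v, hv⟩, false) (by simpa [litIndex] using h1)
  have g2 := h (⟨v, hv⟩, true) (by simpa [litIndex] using h2)
  simp_all

theorem Agrees.insert {n : ℕ} {f : Fin n → Bool} {L : Finset ℕ} (h : Agrees f L) {l : Literal n}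
    (hl : f l.1 = l.2) : Agrees f (insert (litIndex l) L) := by
  intro l' hl'
  rcases Finset.mem_insert.1 hl' with h' | h'
  · rw [litIndex_injective h', hl]
  · exact h l' h'

theorem Agrees.implySet {n : ℕ} {f : Fin n → Bool} {L : Finset ℕ} (h : Agrees f L)
    {l l' : Literal n} (hl : f l.1 = l.2 ∨ f l'.1 = l'.2) :
    Agrees f (implySet (negIndex l) (litIndex l') L) := by
  unfold _root_.implySet
  split
  · rename_i hneg
    rw [negIndex_eq] at hneg
    have := h _ hneg
    refine h.insert (hl.resolve_left fun h' => ?_)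
    simp [h'] at this
  · exact h

theorem eq_head_or_getLast {n : ℕ} {c : Clause2 n} (hc : c.1 ≠ []) {l : Literal n}
    (hl : l ∈ c.1) : l = c.1.head hc ∨ l = c.1.getLast hc := by
  obtain ⟨c, hlen⟩ := c
  match c, hlen, hc, hl with
  | [a], _, _, hl => simpa using hl
  | [a, b], _, _, hl => simpa using hl

theorem sat_head_or_getLast {n : ℕ} {φ : Formula2 n} {f : Fin n → Bool} (hf : φ.SatBy f)
    {c : Clause2 n} (hcφ : c ∈ φ) (hc : c.1 ≠ []) :
    f (c.1.head hc).1 = (c.1.head hc).2 ∨ f (c.1.getLast hc).1 = (c.1.getLast hc).2 := by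
  obtain ⟨l, hl, hfl⟩ := hf c hcφ
  rcases eq_head_or_getLast hc hl with h | h
  · exact .inl (h ▸ hfl)
  · exact .inr (h ▸ hfl)

/-- Soundness of propagation: a satisfying assignment that falsifies one literal of a clause with at
most two literals makes the other true. -/
theorem Agrees.scanSet {n : ℕ} {φ : Formula2 n} {f : Fin n → Bool} (hf : φ.SatBy f)
    {L : Finset ℕ} (h : Agrees f L) : Agrees f (scanSet φ L) := by
  induction φ using List.reverseRecOn with
  | nil => exact h
  | append_singleton φ c ih =>
    have ih := ih fun d hd => hf d (List.mem_append_left _ hd)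
    rw [scanSet_concat]
    by_cases hc : c.1 = []
    · simpa [clauseSet, hc] using ih
    · have := sat_head_or_getLast hf (c := c) (by simp) hc
      rw [clauseSet_of_ne hc]
      exact (ih.implySet this).implySet this.symm

theorem clauseSet_eq_of_scanSet_eq {n : ℕ} {φ : Formula2 n} {L : Finset ℕ}
    (h : scanSet φ L = L) {c : Clause2 n} (hc : c ∈ φ) : clauseSet c L = L := by
  induction φ using List.reverseRecOn with
  | nil => simp at hc
  | append_singleton φ d ih =>
    rw [scanSet_concat, eq_iff_of_chain (subset_scanSet φ L) (subset_clauseSet _ _)] at h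
    rcases List.mem_append.1 hc with hc | hc
    · exact ih h.1 hc
    · rw [List.mem_singleton.1 hc]
      rw [h.1] at h
      exact h.2

theorem mem_of_implySet_eq {x y : ℕ} {L : Finset ℕ} (h : implySet x y L = L) (hx : x ∈ L) :
    y ∈ L := by
  rw [implySet, if_pos hx] at h
  exact Finset.insert_eq_self.1 h

/-- A set fixed by the whole scan is fixed by each implication, since the intermediate sets only
grow. A unit clause `l` counts as `l ∨ l`: it forces nothing by itself but produces a conflict once
`¬l` is chosen. -/
theorem propagated {n : ℕ} {φ : Formula2 n} {L : Finset ℕ} (h : scanSet φ L = L)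
    {c : Clause2 n} (hcφ : c ∈ φ) (hc : c.1 ≠ []) :
    (negIndex (c.1.head hc) ∈ L → litIndex (c.1.getLast hc) ∈ L) ∧
    (negIndex (c.1.getLast hc) ∈ L → litIndex (c.1.head hc) ∈ L) := by
  have := clauseSet_eq_of_scanSet_eq h hcφ
  rw [clauseSet_of_ne hc, eq_iff_of_chain (subset_implySet _ _ _) (subset_implySet _ _ _)] at this
  have h2 := this.2
  rw [this.1] at h2
  exact ⟨mem_of_implySet_eq this.1, mem_of_implySet_eq h2⟩

open Classical in
/-- A satisfying assignment can be changed to agree with a consistent propagated set. -/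
theorem exists_sat_agrees {n : ℕ} {φ : Formula2 n} {L : Finset ℕ} (h : scanSet φ L = L)
    (hL : ¬ Conflict n L) {f : Fin n → Bool} (hf : φ.SatBy f) :
    ∃ g, φ.SatBy g ∧ Agrees g L := by
  let g : Fin n → Bool := fun v =>
    if litIndex (v, true) ∈ L then true else if litIndex (v, false) ∈ L then false else f v
  have hg : Agrees g L := by
    rintro ⟨v, s⟩ hl
    cases s with
    | true => simp [g, hl]
    | false =>
      have : litIndex (v, true) ∉ L := fun h' =>
        hL ⟨v, v.2, by simpa [litIndex] using hl, by simpa [litIndex] using h'⟩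
      simp [g, hl, this]
  -- A literal that `f` makes true and `g` makes false was overridden by `L`, so its negation is in
  -- `L`. Closure then puts the other literal of the clause into `L`, where `g` makes it true.
  have hgf : ∀ l : Literal n, f l.1 = l.2 → g l.1 ≠ l.2 → negIndex l ∈ L := by
    rintro ⟨v, s⟩ h1 h2
    rw [negIndex_eq]
    by_contra hneg
    simp only at h1
    cases s <;> simp_all [g]
  refine ⟨g, fun c hcφ => ?_, hg⟩
  have hc : c.1 ≠ [] := by
    obtain ⟨l, hl, -⟩ := hf c hcφ
    exact List.ne_nil_of_mem hl
  obtain ⟨p1, p2⟩ := propagated h hcφ hc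
  rcases sat_head_or_getLast hf hcφ hc with h' | h'
  · by_cases h2 : g (c.1.head hc).1 = (c.1.head hc).2
    · exact ⟨_, List.head_mem hc, h2⟩
    · exact ⟨_, List.getLast_mem hc, hg _ (p1 (hgf _ h' h2))⟩
  · by_cases h2 : g (c.1.getLast hc).1 = (c.1.getLast hc).2
    · exact ⟨_, List.getLast_mem hc, h2⟩
    · exact ⟨_, List.head_mem hc, hg _ (p2 (hgf _ h' h2))⟩

open Classical in
-- Here no satisfying assignment is given; `L` itself defines one. If the first literal of a clause
-- is not in `L`, its negation is by fullness, and closure supplies the last literal. Propagation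
-- ignores empty clauses, so they are excluded separately.
theorem exists_sat_of_full {n : ℕ} {φ : Formula2 n} {L : Finset ℕ} (h : scanSet φ L = L)
    (hL : ¬ Conflict n L) (hfull : Full n L) (hφ : ∀ c ∈ φ, c.1 ≠ []) :
    ∃ g, φ.SatBy g ∧ Agrees g L := by
  let g : Fin n → Bool := fun v => decide (litIndex (v, true) ∈ L)
  have hg : Agrees g L := by
    rintro ⟨v, s⟩ hl
    cases s with
    | true => simp [g, hl]
    | false =>
      have : litIndex (v, true) ∉ L := fun h' =>
        hL ⟨v, v.2, by simpa [litIndex] using hl, by simpa [litIndex] using h'⟩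
      simp [g, this]
  refine ⟨g, fun c hcφ => ?_, hg⟩
  have hc := hφ c hcφ
  by_cases h2 : litIndex (c.1.head hc) ∈ L
  · exact ⟨_, List.head_mem hc, hg _ h2⟩
  · refine ⟨_, List.getLast_mem hc, hg _ ((propagated h hcφ hc).1 ?_)⟩
    rw [negIndex_eq]
    generalize c.1.head hc = l at h2
    obtain ⟨v, s⟩ := l
    have := hfull v v.2
    cases s <;> simp_all [litIndex]

theorem Agrees.split {n : ℕ} {f : Fin n → Bool} {L A B : Finset ℕ} (h : Agrees f L)
    (hs : Split n L A B) : Agrees f A ∨ Agrees f B := by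
  rcases hs with ⟨-, rfl, -⟩ | ⟨v, hv, -, -, rfl, rfl⟩
  · exact .inl h
  · cases hf : f ⟨v, hv⟩ with
    | false =>
      have := h.insert (l := (⟨v, hv⟩, false)) hf
      exact .inl (by simpa [litIndex] using this)
    | true =>
      have := h.insert (l := (⟨v, hv⟩, true)) hf
      exact .inr (by simpa [litIndex] using this)

theorem implySet_subset {n x y : ℕ} {L : Finset ℕ} (hL : L ⊆ Finset.range n) (hy : y < n) :
    implySet x y L ⊆ Finset.range n := by
  unfold implySet; split
  · exact Finset.insert_subset (Finset.mem_range.2 hy) hL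
  · exact hL

theorem scanSet_subset {n : ℕ} {φ : Formula2 n} {L : Finset ℕ}
    (hL : L ⊆ Finset.range (n + n)) : scanSet φ L ⊆ Finset.range (n + n) := by
  induction φ using List.reverseRecOn with
  | nil => exact hL
  | append_singleton φ c ih =>
    rw [scanSet_concat]
    by_cases hc : c.1 = []
    · simpa [clauseSet, hc] using ih
    · rw [clauseSet_of_ne hc]
      exact implySet_subset (implySet_subset ih (litIndex_lt _)) (litIndex_lt _)

theorem Conflict.mono {n : ℕ} {L M : Finset ℕ} (h : Conflict n L) (hLM : L ⊆ M) :
    Conflict n M := by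
  obtain ⟨v, hv, h1, h2⟩ := h
  exact ⟨v, hv, hLM h1, hLM h2⟩

/-- The map `e ↦ e / 2` from literals to variables is injective on a set without conflicts. -/
theorem card_le_of_not_conflict {n : ℕ} {L : Finset ℕ} (hL : L ⊆ Finset.range (n + n))
    (h : ¬ Conflict n L) : L.card ≤ n := by
  have : L.card ≤ (Finset.range n).card := by
    refine Finset.card_le_card_of_injOn (fun e => e / 2) (fun e he => ?_) ?_
    · have := Finset.mem_range.1 (hL he)
      simp; omega
    · intro e he e' he' heq
      simp only at heq
      have h1 := Finset.mem_range.1 (hL he)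
      by_contra hne
      refine h ⟨e / 2, by omega, ?_, ?_⟩
      · rcases Nat.lt_or_gt_of_ne hne with hlt | hlt
        · rwa [show e / 2 + e / 2 = e by omega]
        · rwa [show e / 2 + e / 2 = e' by omega]
      · rcases Nat.lt_or_gt_of_ne hne with hlt | hlt
        · rwa [show e / 2 + e / 2 + 1 = e' by omega]
        · rwa [show e / 2 + e / 2 + 1 = e by omega]
  simpa using this

/-! ### Two propagations in parallel and their progress. -/

/-- A consistent set has many elements or describes a satisfying assignment. -/
def Progress {n : ℕ} (φ : Formula2 n) (r : ℕ) (L : Finset ℕ) : Prop :=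
  ¬ Conflict n L → r ≤ L.card ∨ (scanSet φ L = L ∧ Full n L)

/-- The invariant of the algorithm that works with the sets `A` and `B` in parallel. -/
structure SolveInv {n : ℕ} (φ : Formula2 n) (L : Finset ℕ) (r : ℕ) (A B : Finset ℕ) : Prop where
  subA : L ⊆ A
  subB : L ⊆ B
  rangeA : A ⊆ Finset.range (n + n)
  rangeB : B ⊆ Finset.range (n + n)
  progA : Progress φ r A
  progB : Progress φ r B
  complete : ∀ f, φ.SatBy f → Agrees f L → ∃ g, φ.SatBy g ∧ (Agrees g A ∨ Agrees g B)

/-- One round of the algorithm. -/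
def Round {n : ℕ} (φ : Formula2 n) (A B A' B' : Finset ℕ) : Prop :=
  (scanSet φ A = A ∧ ¬ Conflict n A ∧ Split n A A' B') ∨
  (scanSet φ B = B ∧ ¬ Conflict n B ∧ Split n B B' A') ∨
  (¬ (scanSet φ A = A ∧ ¬ Conflict n A) ∧ ¬ (scanSet φ B = B ∧ ¬ Conflict n B) ∧
    A' = scanSet φ A ∧ B' = scanSet φ B)

/-- If the new set is conflict-free, so was the old one; as the old one was not both closed and
conflict-free, it was not closed, and the scan added a literal. -/
theorem Progress.scanSet {n : ℕ} {φ : Formula2 n} {r : ℕ} {L : Finset ℕ} (h : Progress φ r L)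
    (hL : ¬ (scanSet φ L = L ∧ ¬ Conflict n L)) : Progress φ (r + 1) (scanSet φ L) := by
  intro hc
  have hc' : ¬ Conflict n L := fun h' => hc (h'.mono (subset_scanSet φ L))
  have hne : _root_.scanSet φ L ≠ L := fun h' => hL ⟨h', hc'⟩
  rcases h hc' with h | h
  · exact .inl (lt_of_le_of_lt h (Finset.card_lt_card ((subset_scanSet φ L).ssubset_of_ne hne.symm)))
  · exact absurd h.1 hne

theorem SolveInv.symm {n : ℕ} {φ : Formula2 n} {L : Finset ℕ} {r : ℕ} {A B : Finset ℕ}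
    (h : SolveInv φ L r A B) : SolveInv φ L r B A where
  subA := h.subB
  subB := h.subA
  rangeA := h.rangeB
  rangeB := h.rangeA
  progA := h.progB
  progB := h.progA
  complete f h1 h2 := by
    obtain ⟨g, h3, h4⟩ := h.complete f h1 h2
    exact ⟨g, h3, h4.symm⟩

/-- Discarding `B` loses nothing: once `A` is closed and conflict-free, every satisfying assignment
can be changed to agree with `A`, and the new one agrees with one side of the split. -/
theorem SolveInv.split {n : ℕ} {φ : Formula2 n} {L : Finset ℕ} {r : ℕ} {A B A' B' : Finset ℕ}
    (h : SolveInv φ L r A B) (hA : scanSet φ A = A) (hc : ¬ Conflict n A)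
    (hs : Split n A A' B') : SolveInv φ L (r + 1) A' B' := by
  have hcomp : ∀ f, φ.SatBy f → Agrees f L →
      ∃ g, φ.SatBy g ∧ (Agrees g A' ∨ Agrees g B') := fun f h1 _ => by
    obtain ⟨g, h3, h4⟩ := exists_sat_agrees hA hc h1
    exact ⟨g, h3, h4.split hs⟩
  rcases hs with ⟨hfull, rfl, rfl⟩ | ⟨v, hv, h1, h2, rfl, rfl⟩
  · exact ⟨h.subA, h.subA, h.rangeA, h.rangeA, fun _ => .inr ⟨hA, hfull⟩,
      fun _ => .inr ⟨hA, hfull⟩, hcomp⟩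
  -- The unassigned variable `v` rules out fullness, so `A` must satisfy the cardinality
  -- alternative, and the new literal raises the count to `r + 1`.
  · have hr : r ≤ A.card := (h.progA hc).resolve_right fun h' => (h'.2 v hv).elim h1 h2
    refine ⟨h.subA.trans (Finset.subset_insert _ _), h.subA.trans (Finset.subset_insert _ _),
      Finset.insert_subset (by simp; omega) h.rangeA,
      Finset.insert_subset (by simp; omega) h.rangeA, fun _ => .inl ?_, fun _ => .inl ?_, hcomp⟩
    · rw [Finset.card_insert_of_notMem h1]; omega
    · rw [Finset.card_insert_of_notMem h2]; omega

theorem SolveInv.round {n : ℕ} {φ : Formula2 n} {L : Finset ℕ} {r : ℕ} {A B A' B' : Finset ℕ}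
    (h : SolveInv φ L r A B) (hs : Round φ A B A' B') : SolveInv φ L (r + 1) A' B' := by
  rcases hs with ⟨h1, h2, h3⟩ | ⟨h1, h2, h3⟩ | ⟨h1, h2, rfl, rfl⟩
  · exact h.split h1 h2 h3
  · exact (h.symm.split h1 h2 h3).symm
  · refine ⟨h.subA.trans (subset_scanSet _ _), h.subB.trans (subset_scanSet _ _),
      scanSet_subset h.rangeA, scanSet_subset h.rangeB, h.progA.scanSet h1, h.progB.scanSet h2,
      fun f g1 g2 => ?_⟩
    obtain ⟨g, h3, h4⟩ := h.complete f g1 g2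
    exact ⟨g, h3, h4.imp (fun k => k.scanSet h3) fun k => k.scanSet h3⟩

theorem SolveInv.init {n : ℕ} {φ : Formula2 n} {L : Finset ℕ} (hL : L ⊆ Finset.range (n + n)) :
    SolveInv φ L 0 L L :=
  ⟨subset_rfl, subset_rfl, hL, hL, fun _ => .inl (Nat.zero_le _), fun _ => .inl (Nat.zero_le _),
    fun f h1 h2 => ⟨f, h1, .inl h2⟩⟩

/-- A conflict-free set cannot have `n + 1` literals, so after `n + 1` rounds it must be closed and
full and hence describes a satisfying assignment, which agrees with the subset `L`. Conversely
completeness keeps some satisfying assignment in agreement with `A` or `B`. -/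
theorem SolveInv.sat_iff {n : ℕ} {φ : Formula2 n} {L A B : Finset ℕ}
    (h : SolveInv φ L (n + 1) A B) :
    (∃ f, φ.SatBy f ∧ Agrees f L) ↔
      (∀ c ∈ φ, c.1 ≠ []) ∧ (¬ Conflict n A ∨ ¬ Conflict n B) := by
  constructor
  · rintro ⟨f, h1, h2⟩
    obtain ⟨g, -, h4⟩ := h.complete f h1 h2
    refine ⟨fun c hc => ?_, h4.imp (fun k => k.not_conflict) fun k => k.not_conflict⟩
    obtain ⟨l, hl, -⟩ := h1 c hc
    exact List.ne_nil_of_mem hl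
  · have aux : ∀ X : Finset ℕ, L ⊆ X → X ⊆ Finset.range (n + n) → Progress φ (n + 1) X →
        (∀ c ∈ φ, c.1 ≠ []) → ¬ Conflict n X → ∃ f, φ.SatBy f ∧ Agrees f L := by
      intro X h1 h2 h3 h4 h5
      have := card_le_of_not_conflict h2 h5
      obtain ⟨h6, h7⟩ := (h3 h5).resolve_left (by omega)
      obtain ⟨g, g1, g2⟩ := exists_sat_of_full h6 h5 h7 h4
      exact ⟨g, g1, g2.mono h1⟩
    rintro ⟨h1, h2 | h2⟩
    · exact aux A h.subA h.rangeA h.progA h1 h2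
    · exact aux B h.subB h.rangeB h.progB h1 h2

/-! ## The 2-SAT algorithm on the machine -/

/-- The assignment `f` makes the literals with code `k` true, and these are `p` distinct
literals. -/
def Extends {n : ℕ} (p : ℕ) (f : Fin n → Bool) (k : ℕ) : Prop :=
  (digitList (n + n) p k).Nodup ∧ Agrees f (digitList (n + n) p k).toFinset

/-- Some assignment satisfies `φ` and extends the partial assignments with codes `k` and `l`. -/
def Compatible {n : ℕ} (p : ℕ) (φ : Formula2 n) (k l : ℕ) : Prop :=
  ∃ f, φ.SatBy f ∧ Extends p f k ∧ Extends p f l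

namespace RProg

/-- Propagate in the array at `b`; register `out` gets `0` if nothing has changed and there is no
conflict. -/
def scanCheck (b out : ℕ) : RProg :=
  .seq (.scan b) (.seq (.check b) (.assign out (.add (.reg 20) (.reg 21))))

/-- One round of the 2-SAT algorithm. -/
def round : RProg :=
  .seq (.scanCheck 0 15) (.seq (.scanCheck 4 16)
    (.branch (.reg 15) (.branch (.reg 16) .skip (.commit 4 0)) (.commit 0 4)))

/-- Put `1` into register `17` if the formula at the address in register `9` has a satisfying
assignment that extends the partial assignments with the codes in the registers `10` and `11`, and
`0` otherwise. -/
def solve : RProg :=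
  .seq (.assign 13 (.const 0)) (.seq (.load 0 10) (.seq (.load 4 11) (.seq (.merge 0 4 3)
    (.seq (.forDown 14 (.add (.reg 1) (.const 1)) .round)
      (.seq (.check 0) (.seq (.assign 15 (.reg 21)) (.seq (.check 4) (.seq (.assign 16 (.reg 21))
        (.branch (.reg 13) (.assign 17 (.const 0))
          (.branch (.reg 15) (.branch (.reg 16) (.assign 17 (.const 0)) (.assign 17 (.const 1)))
            (.assign 17 (.const 1))))))))))))

end RProg

open M2SAT in
theorem run_scanCheck {W n b out : ℕ} {s : RState} {φ : Formula2 n} {L : Finset ℕ} (hb : b < 9)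
    (ho : 13 < out ∧ out < 20) (h1 : s.reg 1 = n)
    (hφ : Holds s.mem (s.reg 9) (encFormula φ))
    (hdis : s.reg 9 + (encFormula φ).length ≤ s.reg b) (hW : s.reg b + (n + n) + 2 ≤ W)
    (hφW : φ.length ≤ W) (hL : Arr s.mem (s.reg b) (n + n) L) (h13 : s.reg 13 ≤ 1) :
    Run W (.scanCheck b out) s (φ.length * 130 + n * 26 + 30) fun s' =>
      (∀ r < 20, r ≠ 12 → r ≠ 13 → r ≠ out → s'.reg r = s.reg r) ∧
      (∀ a, a < s.reg b ∨ s.reg b + (n + n) ≤ a → s'.mem a = s.mem a) ∧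
      s'.reg 12 = s.reg 9 + (encFormula φ).length ∧
      s'.reg 13 ≤ 1 ∧ (s'.reg 13 = 0 ↔ s.reg 13 = 0 ∧ ∀ c ∈ φ, c.1 ≠ []) ∧
      s'.reg out ≤ n + 1 ∧
      (s'.reg out = 0 ↔ scanSet φ L = L ∧ ¬ Conflict n L) ∧
      Arr s'.mem (s.reg b) (n + n) (scanSet φ L) := by
  simp only [Run, RProg.scanCheck, wp_seq]
  refine (run_scan hb hφ hdis hW hφW hL h13).wp ?_
  rintro t1 s1 ht1 ⟨hr1, hm1, h12, h13', hbad, h20, hch, ha⟩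
  have hb1 : s1.reg b = s.reg b := hr1 b (by omega) (by omega) (by omega)
  rw [← hb1] at ha
  refine (run_check (n := n) (by omega) (by rw [hr1 1] <;> omega) (by omega) ha).wp ?_
  rintro t2 s2 ht2 ⟨hr2, hm2, h21, hconf⟩
  rw [hb1] at ha
  simp only [wp_assign, RExpr.Fits, RExpr.eval, RExpr.cost, hr2 20 (by omega)]
  have hne12 : 12 ≠ out := by omega
  have hne13 : 13 ≠ out := by omega
  refine ⟨by omega, by omega, fun r g1 g2 g3 g4 => ?_, fun a h => ?_, ?_, ?_, ?_, ?_, ?_, ?_⟩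
  · simp only [RState.setr_reg, g4, if_false]
    rw [hr2 r (by omega), hr1 r g1 g2 g3]
  · simp only [RState.setr_mem, hm2]; exact hm1 a h
  · simp only [RState.setr_reg, hne12, if_false]; rw [hr2 12 (by omega), h12]
  · simp only [RState.setr_reg, hne13, if_false]; rw [hr2 13 (by omega)]; exact h13'
  · simp only [RState.setr_reg, hne13, if_false]; rw [hr2 13 (by omega)]; exact hbad
  · simp only [RState.setr_reg, if_true]; omega
  · simp only [RState.setr_reg, if_true]
    rw [Nat.add_eq_zero_iff, hch, hconf]
    constructor
    · rintro ⟨g1, g2⟩; rw [g1] at g2; exact ⟨g1, g2⟩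
    · rintro ⟨g1, g2⟩; rw [g1]; exact ⟨rfl, g2⟩
  · simp only [RState.setr_mem, hm2]; exact ha

/-- The part of the state that the 2-SAT algorithm only reads: registers and the formula. -/
structure SolveCtx {n : ℕ} (W p : ℕ) (φ : Formula2 n) (s : RState) : Prop where
  n_pos : 0 < n
  reg1 : s.reg 1 = n
  reg2 : s.reg 2 = p
  reg3 : s.reg 3 = n + n
  reg4 : s.reg 4 = s.reg 0 + (n + n)
  formula : Holds s.mem (s.reg 9) (M2SAT.encFormula φ)
  disjoint : s.reg 9 + (M2SAT.encFormula φ).length ≤ s.reg 0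
  bound : s.reg 0 + 4 * n + 4 ≤ W
  bound_p : p ≤ W
  bound_length : φ.length ≤ W

theorem SolveCtx.congr {n W p : ℕ} {φ : Formula2 n} {s s' : RState} (h : SolveCtx W p φ s)
    (hr : ∀ r < 10, s'.reg r = s.reg r) (hm : ∀ a < s.reg 0, s'.mem a = s.mem a) :
    SolveCtx W p φ s' := by
  obtain ⟨h0, h1, h2, h3, h4, h5, h6, h7, h8, h9⟩ := h
  refine ⟨h0, ?_, ?_, ?_, ?_, ?_, ?_, ?_, h8, h9⟩
  · rw [hr 1 (by omega), h1]
  · rw [hr 2 (by omega), h2]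
  · rw [hr 3 (by omega), h3]
  · rw [hr 4 (by omega), hr 0 (by omega), h4]
  · rw [hr 9 (by omega)]
    exact h5.congr fun i _ h => hm i (by omega)
  · rw [hr 9 (by omega), hr 0 (by omega)]; exact h6
  · rw [hr 0 (by omega)]; exact h7

open M2SAT in
-- Both sets are scanned before either is tested. A zero in register 15 or 16 certifies that the
-- scan changed nothing, so the array still holds the set to branch from. The program prefers `A` if
-- both are closed and conflict-free; `Round` leaves this choice open.
theorem run_round {W n p : ℕ} {s : RState} {φ : Formula2 n} {A B : Finset ℕ}
    (hs : SolveCtx W p φ s) (hA : Arr s.mem (s.reg 0) (n + n) A)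
    (hB : Arr s.mem (s.reg 4) (n + n) B) (h13 : s.reg 13 ≤ 1) :
    Run W .round s (φ.length * 260 + n * 106 + 96) fun s' =>
      (∀ r < 12, s'.reg r = s.reg r) ∧ s'.reg 14 = s.reg 14 ∧
      (∀ a, a < s.reg 0 ∨ s.reg 0 + 4 * n ≤ a → s'.mem a = s.mem a) ∧
      s'.reg 12 = s.reg 9 + (encFormula φ).length ∧
      s'.reg 13 ≤ 1 ∧ (s'.reg 13 = 0 ↔ s.reg 13 = 0 ∧ ∀ c ∈ φ, c.1 ≠ []) ∧
      ∃ A' B', Round φ A B A' B' ∧ Arr s'.mem (s.reg 0) (n + n) A' ∧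
        Arr s'.mem (s.reg 4) (n + n) B' := by
  have hn := hs.n_pos
  have e4 := hs.reg4
  have hW := hs.bound
  have hdis := hs.disjoint
  simp only [Run, RProg.round, wp_seq]
  refine (run_scanCheck (by omega) (by omega) hs.reg1 hs.formula hs.disjoint (by omega)
    hs.bound_length hA h13).wp ?_
  rintro t1 s1 ht1 ⟨hr1, hm1, h12, h13a, hbad1, h15, h15', hA1⟩
  have hr1' : ∀ r < 12, s1.reg r = s.reg r := fun r h =>
    hr1 r (by omega) (by omega) (by omega) (by omega)
  have hs1 : SolveCtx W p φ s1 := hs.congr (fun r h => hr1' r (by omega)) fun a h => hm1 a (.inl h)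
  have hB1 : Arr s1.mem (s1.reg 4) (n + n) B := by
    rw [hr1' 4 (by omega)]
    exact hB.congr fun a g1 g2 => hm1 a (by omega)
  refine (run_scanCheck (by omega) (by omega) hs1.reg1 hs1.formula
    (by rw [hr1' 9 (by omega), hr1' 4 (by omega)]; omega) (by rw [hr1' 4 (by omega)]; omega)
    hs.bound_length hB1 h13a).wp ?_
  rw [hr1' 4 (by omega)]
  rintro t2 s2 ht2 ⟨hr2, hm2, h12b, h13b, hbad2, h16, h16', hB2⟩
  have hr2' : ∀ r < 12, s2.reg r = s.reg r := fun r h => by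
    rw [hr2 r (by omega) (by omega) (by omega) (by omega), hr1' r h]
  have hA2 : Arr s2.mem (s.reg 0) (n + n) (scanSet φ A) :=
    hA1.congr fun a g1 g2 => hm2 a (by omega)
  have e12 : s2.reg 12 = s.reg 9 + (encFormula φ).length := by rw [h12b, hr1' 9 (by omega)]
  have e13 : s2.reg 13 = 0 ↔ s.reg 13 = 0 ∧ ∀ c ∈ φ, c.1 ≠ [] := by rw [hbad2, hbad1]; tauto
  have e14 : s2.reg 14 = s.reg 14 := by rw [hr2 14, hr1 14] <;> omega
  have e15 : s2.reg 15 = s1.reg 15 := by rw [hr2 15] <;> omega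
  have em : ∀ a, a < s.reg 0 ∨ s.reg 0 + 4 * n ≤ a → s2.mem a = s.mem a := fun a h => by
    rw [hm2 a (by omega), hm1 a (by omega)]
  simp only [wp_branch, wp_skip, RExpr.Fits, RExpr.eval, RExpr.cost, e15]
  have q1 := hr2' 1 (by omega)
  have q3 := hr2' 3 (by omega)
  have q0 := hr2' 0 (by omega)
  have q4 := hr2' 4 (by omega)
  rw [hs.reg1] at q1
  rw [hs.reg3] at q3
  refine ⟨by omega, fun hne => ⟨by omega, fun hne' => ?_, fun hz' => ?_⟩, fun hz => ?_⟩
  · refine ⟨by omega, hr2', e14, em, e12, h13b, e13, scanSet φ A, scanSet φ B,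
      .inr (.inr ⟨fun h => hne (h15'.2 h), fun h => hne' (h16'.2 h), rfl, rfl⟩), hA2, hB2⟩
  · obtain ⟨g1, g2⟩ := h16'.1 hz'
    rw [g1] at hB2
    refine (run_commit (W := W) (n := n) (L := B) (by omega) (by omega) q1 q3 (by omega) (by omega)
      (by omega) (by rw [q4]; exact hB2)).wp ?_
    rw [q0, q4]
    rintro t3 s3 ht3 ⟨hr3, hm3, X, Y, hsplit, hX, hY⟩
    refine ⟨by omega, fun r h => by rw [hr3 r (by omega), hr2' r h], ?_, fun a h => ?_, ?_, ?_, ?_,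
      Y, X, .inr (.inl ⟨g1, g2, hsplit⟩), hY, hX⟩
    · rw [hr3 14 (by omega), e14]
    · rw [hm3 a (by omega) (by omega), em a h]
    · rw [hr3 12 (by omega), e12]
    · rw [hr3 13 (by omega)]; exact h13b
    · rw [hr3 13 (by omega)]; exact e13
  · obtain ⟨g1, g2⟩ := h15'.1 hz
    rw [g1] at hA2
    refine (run_commit (W := W) (n := n) (L := A) (by omega) (by omega) q1 q3 (by omega) (by omega)
      (by omega) (by rw [q0]; exact hA2)).wp ?_
    rw [q0, q4]
    rintro t3 s3 ht3 ⟨hr3, hm3, X, Y, hsplit, hX, hY⟩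
    refine ⟨by omega, fun r h => by rw [hr3 r (by omega), hr2' r h], ?_, fun a h => ?_, ?_, ?_, ?_,
      X, Y, .inl ⟨g1, g2, hsplit⟩, hX, hY⟩
    · rw [hr3 14 (by omega), e14]
    · rw [hm3 a (by omega) (by omega), em a h]
    · rw [hr3 12 (by omega), e12]
    · rw [hr3 13 (by omega)]; exact h13b
    · rw [hr3 13 (by omega)]; exact e13

theorem digitList_toFinset_subset {b : ℕ} (hb : 0 < b) (p k : ℕ) :
    (digitList b p k).toFinset ⊆ Finset.range b := by
  intro e he
  exact Finset.mem_range.2 (digitList_lt hb (List.mem_toFinset.1 he))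

/-- The time bound of the 2-SAT algorithm. -/
def solveTime (n p m K : ℕ) : ℕ :=
  2 * (p * (K * 14 + 30)) + (n + 1) * (m * 260 + n * 106 + 102) + (n * 148 + 100)

open M2SAT in
-- The search starts with both candidates equal to the union of the two decoded sets. Contradictory
-- codes need no extra test: a conflict in the union persists in all larger sets.
theorem run_solve {W n p K : ℕ} {s : RState} {φ : Formula2 n} (hs : SolveCtx W p φ s)
    (h10 : s.reg 10 ≤ K) (h11 : s.reg 11 ≤ K) (hK : K + 1 ≤ W) :
    Run W .solve s (solveTime n p φ.length K) fun s' =>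
      (∀ r < 12, s'.reg r = s.reg r) ∧
      (∀ a, a < s.reg 0 ∨ s.reg 0 + 4 * n ≤ a → s'.mem a = s.mem a) ∧
      s'.reg 12 = s.reg 9 + (encFormula φ).length ∧ s'.reg 17 ≤ 1 ∧
      (s'.reg 17 = 1 ↔ Compatible p φ (s.reg 10) (s.reg 11)) := by
  have hn := hs.n_pos
  have e4 := hs.reg4
  have hW := hs.bound
  simp only [Run, RProg.solve, wp_seq, wp_assign, RExpr.Fits, RExpr.eval, RExpr.cost]
  refine ⟨by omega, ?_⟩
  refine (run_load (W := W) (n := n) (p := p) (by omega) (by omega) (by simp [hs.reg3]) hn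
    (by simp [hs.reg2]) hs.bound_p (by simp; omega) (by simp; omega) (by simp)).wp ?_
  simp only [RState.setr_reg, RState.setr_mem, Nat.reduceEqDiff, if_true, if_false, true_and]
  rintro t1 s1 ht1 ⟨hr1, hm1, h13a, hbad1, hA1⟩
  have hr1' : ∀ r < 13, s1.reg r = s.reg r := fun r h => by
    rw [hr1 r (by omega) (by omega), if_neg (by omega)]
  refine (run_load (W := W) (n := n) (p := p) (by omega) (by omega)
    (by rw [hr1' 3 (by omega), hs.reg3]) hn
    (by rw [hr1' 2 (by omega), hs.reg2]) hs.bound_p (by rw [hr1' 4 (by omega)]; omega)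
    (by rw [hr1' 11 (by omega)]; omega) h13a).wp ?_
  rw [hr1' 4 (by omega), hr1' 11 (by omega)]
  rintro t2 s2 ht2 ⟨hr2, hm2, h13b, hbad2, hB2⟩
  have hr2' : ∀ r < 13, s2.reg r = s.reg r := fun r h => by
    rw [hr2 r (by omega) (by omega), hr1' r h]
  have hA2 : Arr s2.mem (s.reg 0) (n + n) (digitList (n + n) p (s.reg 10)).toFinset :=
    hA1.congr fun a g1 g2 => hm2 a (by omega)
  refine (run_merge (W := W) (L := (digitList (n + n) p (s.reg 10)).toFinset)
    (M := (digitList (n + n) p (s.reg 11)).toFinset) (by omega) (by omega) (by omega)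
    (by rw [hr2' 0 (by omega), hr2' 3 (by omega), hr2' 4 (by omega), hs.reg3, e4])
    (by rw [hr2' 3 (by omega), hr2' 4 (by omega), hs.reg3, e4]; omega)
    (by rw [hr2' 3 (by omega), hr2' 0 (by omega), hs.reg3]; exact hA2)
    (by rw [hr2' 3 (by omega), hr2' 4 (by omega), hs.reg3]; exact hB2)).wp ?_
  rw [hr2' 3 (by omega), hr2' 4 (by omega), hr2' 0 (by omega), hs.reg3]
  rintro t3 s3 ht3 ⟨⟨hr3, hm3⟩, hA3, hB3⟩
  set L := (digitList (n + n) p (s.reg 10)).toFinset ∪ (digitList (n + n) p (s.reg 11)).toFinset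
    with hL
  have hr3' : ∀ r < 13, s3.reg r = s.reg r := fun r h => by rw [hr3 r (by omega), hr2' r h]
  have hm3' : ∀ a, a < s.reg 0 ∨ s.reg 0 + 4 * n ≤ a → s3.mem a = s.mem a := fun a h => by
    rw [hm3 a (by omega), hm2 a (by omega), hm1 a (by omega)]
  have hLsub : L ⊆ Finset.range (n + n) := Finset.union_subset
    (digitList_toFinset_subset (by omega) _ _) (digitList_toFinset_subset (by omega) _ _)
  have e13 : s3.reg 13 = 0 ↔ (digitList (n + n) p (s.reg 10)).Nodup ∧
      (digitList (n + n) p (s.reg 11)).Nodup := by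
    rw [hr3 13 (by omega), hbad2, hbad1]
  have key := run_forDown (W := W) (r := 14) (T := φ.length * 260 + n * 106 + 96) (K := n + 1)
    (e := .add (.reg 1) (.const 1)) (s := s3) (body := .round)
    -- The counter `k` means that `n + 1 - k` rounds are done. The end address and the flag for
    -- empty clauses come from a scan, so they are claimed only for `k ≤ n`, after the first round.
    (fun k s' => (∀ r < 12, s'.reg r = s.reg r) ∧
      (∀ a, a < s.reg 0 ∨ s.reg 0 + 4 * n ≤ a → s'.mem a = s.mem a) ∧
      (k ≤ n → s'.reg 12 = s.reg 9 + (encFormula φ).length) ∧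
      s'.reg 13 ≤ 1 ∧ (s'.reg 13 = 0 ↔ s3.reg 13 = 0 ∧ (k ≤ n → ∀ c ∈ φ, c.1 ≠ [])) ∧
      k ≤ n + 1 ∧ ∃ A B, SolveInv φ L (n + 1 - k) A B ∧ Arr s'.mem (s.reg 0) (n + n) A ∧
        Arr s'.mem (s.reg 4) (n + n) B)
    (by omega) (by omega) (by simp [RExpr.eval, hr3', hs.reg1])
    (by simp [RExpr.Fits, RExpr.eval, hr3', hs.reg1]; omega) ?_ ?_
  · refine key.wp ?_
    rintro t4 s4 ht4 ⟨hr4, hm4, h12, h13, hbad, -, A, B, hinv, hA, hB⟩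
    have q0 := hr4 0 (by omega)
    refine (run_check (W := W) (n := n) (L := A) (by omega) (by rw [hr4 1 (by omega), hs.reg1])
      (by omega) (by rw [q0]; exact hA)).wp ?_
    rintro t5 s5 ht5 ⟨hr5, hm5, hle5, hc5⟩
    refine ⟨by omega, ?_⟩
    have q4 : (s5.setr 15 (s5.reg 21)).reg 4 = s.reg 4 := by
      simp [hr5, hr4]
    refine (run_check (W := W) (n := n) (L := B) (by omega)
      (by simp [hr5, hr4, hs.reg1]) (by omega)
      (by rw [q4]; simp only [RState.setr_mem, hm5]; exact hB)).wp ?_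
    rintro t6 s6 ht6 ⟨hr6, hm6, hle6, hc6⟩
    have z13 : s6.reg 13 = s4.reg 13 := by rw [hr6 13 (by omega)]; simp [hr5]
    have z15 : s6.reg 15 = s5.reg 21 := by rw [hr6 15 (by omega)]; simp
    have zr : ∀ r < 13, s6.reg r = s4.reg r := fun r h => by
      have : r ≠ 15 := by omega
      rw [hr6 r (by omega)]; simp [this, hr5 r (by omega)]
    have zm : ∀ a, a < s.reg 0 ∨ s.reg 0 + 4 * n ≤ a → s6.mem a = s.mem a := fun a h => by
      rw [hm6]; simp only [RState.setr_mem, hm5]; exact hm4 a h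
    have htime : ∀ u, u ≤ 20 → 1 + 1 + (t1 + (t2 + (t3 + (t4 + (t5 + (1 + 1 +
        (t6 + (1 + 1 + u)))))))) ≤ solveTime n p φ.length K := by
      intro u hu
      simp only [RExpr.cost] at ht4
      have g1 : p * (s.reg 10 * 14 + 30) ≤ p * (K * 14 + 30) := Nat.mul_le_mul_left _ (by omega)
      have g2 : p * (s.reg 11 * 14 + 30) ≤ p * (K * 14 + 30) := Nat.mul_le_mul_left _ (by omega)
      rw [show φ.length * 260 + n * 106 + 96 + 6 = φ.length * 260 + n * 106 + 102 by ring] at ht4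
      unfold solveTime
      omega
    -- Extending both codes amounts to agreeing with the union of their literals, together with
    -- distinctness of the digits of each, which the flag records.
    have hcompat : Compatible p φ (s.reg 10) (s.reg 11) ↔
        s4.reg 13 = 0 ∧ (s5.reg 21 = 0 ∨ s6.reg 21 = 0) := by
      have hsat := SolveInv.sat_iff (by simpa using hinv)
      rw [hbad, hc5, hc6, e13]
      simp only [Nat.zero_le, true_imp_iff]
      rw [and_assoc, ← hsat]
      constructor
      · rintro ⟨f, h1, h2, h3⟩
        refine ⟨⟨h2.1, h3.1⟩, f, h1, fun l hl => ?_⟩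
        rcases Finset.mem_union.1 hl with hl | hl
        · exact h2.2 l hl
        · exact h3.2 l hl
      · rintro ⟨⟨h1, h2⟩, f, h3, h4⟩
        exact ⟨f, h3, ⟨h1, h4.mono Finset.subset_union_left⟩, ⟨h2, h4.mono Finset.subset_union_right⟩⟩
    have hreg : ∀ v, ∀ r < 12, ((s6.setr 16 (s6.reg 21)).setr 17 v).reg r = s.reg r := by
      intro v r h
      have : r ≠ 17 ∧ r ≠ 16 := by omega
      simp [this, zr r (by omega), hr4 r h]
    have h12' : ∀ v, ((s6.setr 16 (s6.reg 21)).setr 17 v).reg 12 =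
        s.reg 9 + (encFormula φ).length := by
      intro v; simp [zr, h12]
    simp only [wp_branch, wp_assign, RExpr.Fits, RExpr.eval, RExpr.cost, RState.setr_reg,
      Nat.reduceEqDiff, if_true, if_false, z13, z15]
    simp only [RState.setr_reg, Nat.reduceEqDiff, if_false] at hreg h12'
    refine ⟨by omega, by omega, fun hne => ⟨by omega, htime _ (by omega), hreg 0, zm, h12' 0,
      by omega, by rw [hcompat]; simp [hne]⟩, fun hz => ⟨by omega, fun hne1 =>
        ⟨by omega, fun hne2 => ⟨by omega, htime _ (by omega), hreg 0, zm, h12' 0,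
          by omega, by rw [hcompat]; simp [hne1, hne2]⟩,
        fun hz2 => ⟨by omega, htime _ (by omega), hreg 1, zm, h12' 1,
          by omega, by rw [hcompat]; simp [hz, hz2]⟩⟩, fun hz1 =>
        ⟨by omega, htime _ (by omega), hreg 1, zm, h12' 1, by omega, by rw [hcompat]; simp [hz, hz1]⟩⟩⟩
  · refine ⟨fun r h => ?_, hm3', fun h => by omega, ?_, ?_, le_rfl, L, L, ?_, hA3, hB3⟩
    · have : r ≠ 14 := by omega
      simp [this, hr3' r (by omega)]
    · simp [hr3, h13b]
    · simp
    · simpa using SolveInv.init hLsub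
  · rintro k s' hk ⟨hr, hm, h12, h13, hbad, -, A, B, hinv, hA, hB⟩
    have hne : ∀ r < 12, (s'.setr 14 k).reg r = s.reg r := fun r h => by
      have : r ≠ 14 := by omega
      simp [this, hr r h]
    refine (run_round (W := W) (p := p) (φ := φ) (A := A) (B := B)
      (hs.congr (fun r h => hne r (by omega)) fun a h => hm a (.inl h)) (by rw [hne 0 (by omega)]; exact hA)
      (by rw [hne 4 (by omega)]; exact hB) (by simpa using h13)).mono le_rfl ?_
    rw [hne 0 (by omega), hne 4 (by omega), hne 9 (by omega)]
    rintro s'' ⟨g1, g2, g3, g4, g5, g6, A', B', hround, hA', hB'⟩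
    refine ⟨by simpa using g2, fun r h => by rw [g1 r h, hne r h],
      fun a h => by rw [g3 a h]; exact hm a h, fun _ => g4, g5, ?_, by omega, A', B', ?_, hA', hB'⟩
    · rw [g6]
      simp only [RState.setr_reg, Nat.reduceEqDiff, if_false, hbad]
      constructor
      · rintro ⟨⟨k1, k2⟩, k3⟩; exact ⟨k1, fun _ => k3⟩
      · rintro ⟨k1, k2⟩; exact ⟨⟨k1, fun _ => k2 (by omega)⟩, k2 (by omega)⟩
    · have := hinv.round hround
      rwa [show n + 1 - (k + 1) + 1 = n + 1 - k by omega] at this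

/-! ## Dynamic programming over the stages -/

/-- The codes that can follow the codes in `S` across a stage with formula `φ`. -/
def reachStep {n : ℕ} (p N : ℕ) (S : Set ℕ) (φ : Formula2 n) : Set ℕ :=
  {l | l < N ∧ ∃ k ∈ S, Compatible p φ k l}

/-- The codes that can be reached after the stages of the list. -/
def reach {n : ℕ} (p N : ℕ) (φs : List (Formula2 n)) : Set ℕ :=
  φs.foldl (reachStep p N) {k | k < N}

theorem reach_concat {n p N : ℕ} (φs : List (Formula2 n)) (φ : Formula2 n) :
    reach p N (φs ++ [φ]) = reachStep p N (reach p N φs) φ := by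
  simp [reach]

namespace RProg

/-- Put `1` into cell number (register `11`) of the array at register `7` if that code can follow
the code in register `10`. -/
def tryPair : RProg :=
  .seq .solve (.branch (.reg 17) (.branch (.mem (.add (.reg 5) (.reg 10)))
    (.store (.add (.reg 7) (.reg 11)) (.const 1)) .skip) .skip)

/-- Replace the reachable codes in the array at register `5` by those after the next stage. -/
def stage : RProg :=
  .seq (.fill 7 6 0) (.seq (.forDown 10 (.reg 6) (.forDown 11 (.reg 6) .tryPair))
    (.seq (.copy 7 5 6) (.assign 9 (.reg 12))))

end RProg

/-- The part of the state that a stage only reads. -/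
structure StageCtx {n : ℕ} (W p N : ℕ) (φ : Formula2 n) (s : RState) : Prop
    extends SolveCtx W p φ s where
  reg5 : s.reg 5 = s.reg 0 + 4 * n
  reg6 : s.reg 6 = N
  reg7 : s.reg 7 = s.reg 0 + 4 * n + N
  N_pos : 0 < N
  space : s.reg 0 + 4 * n + 2 * N + 4 ≤ W

theorem StageCtx.congr {n W p N : ℕ} {φ : Formula2 n} {s s' : RState} (h : StageCtx W p N φ s)
    (hr : ∀ r < 10, s'.reg r = s.reg r) (hm : ∀ a < s.reg 0, s'.mem a = s.mem a) :
    StageCtx W p N φ s' := by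
  refine ⟨h.toSolveCtx.congr hr hm, ?_, ?_, ?_, h.N_pos, ?_⟩
  · rw [hr 5 (by omega), hr 0 (by omega), h.reg5]
  · rw [hr 6 (by omega), h.reg6]
  · rw [hr 7 (by omega), hr 0 (by omega), h.reg7]
  · rw [hr 0 (by omega)]; exact h.space

open M2SAT in
-- The 2-SAT test runs even if the source code is unreachable; thus register 12 always ends at the
-- end of the formula.
theorem run_tryPair {W n p N : ℕ} {s : RState} {φ : Formula2 n} {R Q : Finset ℕ}
    (hs : StageCtx W p N φ s) (h10 : s.reg 10 < N) (h11 : s.reg 11 < N)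
    (hR : Arr s.mem (s.reg 5) N R) (hQ : Arr s.mem (s.reg 7) N Q) :
    Run W .tryPair s (solveTime n p φ.length N + 12) fun s' =>
      (∀ r < 12, s'.reg r = s.reg r) ∧ (∀ a < s.reg 0, s'.mem a = s.mem a) ∧
      s'.reg 12 = s.reg 9 + (encFormula φ).length ∧ Arr s'.mem (s.reg 5) N R ∧
      ∃ Q', Arr s'.mem (s.reg 7) N Q' ∧
        ∀ l, l ∈ Q' ↔ l ∈ Q ∨ (l = s.reg 11 ∧ s.reg 10 ∈ R ∧ Compatible p φ (s.reg 10) l) := by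
  have e5 := hs.reg5
  have e7 := hs.reg7
  have hW := hs.space
  simp only [Run, RProg.tryPair, wp_seq]
  refine (run_solve (K := N) hs.toSolveCtx h10.le h11.le (by omega)).wp ?_
  rintro t s1 ht ⟨hr1, hm1, h12, h17, hc⟩
  have hR1 : Arr s1.mem (s.reg 5) N R := hR.congr fun a _ _ => hm1 a (by omega)
  have hQ1 : Arr s1.mem (s.reg 7) N Q := hQ.congr fun a _ _ => hm1 a (by omega)
  have hcell := hR1.le_one h10
  simp only [wp_branch, wp_skip, wp_store, RExpr.Fits, RExpr.eval, RExpr.cost,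
    hr1 5 (by omega), hr1 7 (by omega), hr1 10 (by omega), hr1 11 (by omega), RState.setm_reg]
  refine ⟨by omega, fun hne => ⟨by omega, fun hne2 => ⟨by omega, by omega, by omega, hr1,
    fun a h => ?_, h12, ?_, insert (s.reg 11) Q, hQ1.setm _, fun l => ?_⟩, fun hz2 =>
    ⟨by omega, hr1, fun a h => hm1 a (.inl h), h12, hR1, Q, hQ1, fun l => ?_⟩⟩, fun hz =>
    ⟨by omega, hr1, fun a h => hm1 a (.inl h), h12, hR1, Q, hQ1, fun l => ?_⟩⟩
  · have : a ≠ s.reg 7 + s.reg 11 := by omega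
    simp [this, hm1 a (.inl h)]
  · refine hR1.congr fun a g1 g2 => ?_
    have : a ≠ s.reg 7 + s.reg 11 := by omega
    simp [this]
  · have hk : s.reg 10 ∈ R := not_not.1 fun h => hne2 ((hR1.eq_zero_iff h10).2 h)
    have := hc.1 (by omega)
    rw [Finset.mem_insert, or_comm]
    refine or_congr_right ⟨?_, fun h => h.1⟩
    rintro rfl
    exact ⟨rfl, hk, this⟩
  · have hk : s.reg 10 ∉ R := (hR1.eq_zero_iff h10).1 hz2
    simp [hk]
  · have : ¬ Compatible p φ (s.reg 10) (s.reg 11) := fun h => by have := hc.2 h; omega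
    constructor
    · exact .inl
    · rintro (h | ⟨rfl, -, h⟩)
      · exact h
      · exact absurd h this

/-- The time bound for a stage. -/
def stageTime (n p m N : ℕ) : ℕ :=
  N * (N * (solveTime n p m N + 18) + 10) + N * 25 + 14

open M2SAT in
-- The new codes are collected in a second array, so that the old ones stay readable for all pairs,
-- and are copied back only at the end.
theorem run_stage {W n p N : ℕ} {s : RState} {φ : Formula2 n} {R : Finset ℕ}
    (hs : StageCtx W p N φ s) (hR : Arr s.mem (s.reg 5) N R) :
    Run W .stage s (stageTime n p φ.length N) fun s' =>
      (∀ r < 9, s'.reg r = s.reg r) ∧ (∀ a < s.reg 0, s'.mem a = s.mem a) ∧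
      s'.reg 9 = s.reg 9 + (encFormula φ).length ∧
      ∃ R', Arr s'.mem (s.reg 5) N R' ∧
        ∀ l, l ∈ R' ↔ l < N ∧ ∃ k < N, k ∈ R ∧ Compatible p φ k l := by
  have e5 := hs.reg5
  have e6 := hs.reg6
  have e7 := hs.reg7
  have hW := hs.space
  have hN := hs.N_pos
  simp only [Run, RProg.stage, wp_seq]
  refine (run_fill_zero (W := W) (b := 7) (len := 6) (by omega) (by omega) (by omega)).wp ?_
  rw [e6]
  rintro t1 s1 ht1 ⟨⟨hr1, hm1⟩, hQ1⟩
  have hs1 : StageCtx W p N φ s1 := hs.congr (fun r h => hr1 r (by omega)) fun a h => hm1 a (by omega)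
  have hR1 : Arr s1.mem (s.reg 5) N R := hR.congr fun a _ _ => hm1 a (by omega)
  have outer := run_forDown (W := W) (r := 10) (T := N * (solveTime n p φ.length N + 18) + 4)
    (K := N) (e := .reg 6) (s := s1) (body := .forDown 11 (.reg 6) .tryPair)
    -- `Q` holds the successors of the sources from `k` on. Register 12 is meaningful once a pair
    -- has been tried, which `0 < N` guarantees by the end.
    (fun k s' => k ≤ N ∧ (∀ r < 10, s'.reg r = s.reg r) ∧ (∀ a < s.reg 0, s'.mem a = s.mem a) ∧
      (k < N → s'.reg 12 = s.reg 9 + (encFormula φ).length) ∧ Arr s'.mem (s.reg 5) N R ∧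
      ∃ Q, Arr s'.mem (s.reg 7) N Q ∧
        ∀ l, l ∈ Q ↔ l < N ∧ ∃ k' < N, k ≤ k' ∧ k' ∈ R ∧ Compatible p φ k' l)
    (by omega) (by omega) (by simp [RExpr.eval, hr1, e6])
    (by simp [RExpr.Fits, hr1, e6]; omega) ?_ ?_
  · refine outer.wp ?_
    rintro t2 s2 ht2 ⟨-, hr2, hm2, h12, hR2, Q, hQ2, hQ⟩
    refine (run_copy (W := W) (src := 7) (dst := 5) (len := 6) (L := Q) (by omega) (by omega)
      (by omega) ?_ ?_ ?_ ?_).wp ?_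
    · rw [hr2 7 (by omega), hr2 6 (by omega)]; omega
    · rw [hr2 5 (by omega), hr2 6 (by omega)]; omega
    · rw [hr2 5 (by omega), hr2 6 (by omega), hr2 7 (by omega)]; omega
    · rw [hr2 6 (by omega), hr2 7 (by omega), e6]; exact hQ2
    rw [hr2 5 (by omega), hr2 6 (by omega), e6]
    rintro t3 s3 ht3 ⟨⟨hr3, hm3⟩, ha3⟩
    simp only [wp_assign, RExpr.Fits, RExpr.eval, RExpr.cost, hr3 12 (by omega), h12 hN]
    have hdis := hs.disjoint
    refine ⟨by omega, ?_, fun r h => ?_, fun a h => ?_, by simp, Q, ha3, ?_⟩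
    · simp only [RExpr.cost] at ht2
      rw [show N * (solveTime n p φ.length N + 18) + 4 + 6 =
        N * (solveTime n p φ.length N + 18) + 10 by ring] at ht2
      unfold stageTime
      omega
    · simp [h.ne, hr3 r (by omega), hr2 r (by omega)]
    · simp only [RState.setr_mem]; rw [hm3 a (by omega), hm2 a h]
    · simpa using hQ
  · refine ⟨le_rfl, fun r h => ?_, fun a h => hm1 a (by omega), fun h => by omega, hR1, ∅, hQ1, ?_⟩
    · have : r ≠ 10 := by omega
      simp [this, hr1 r (by omega)]
    · intro l
      simp only [Finset.notMem_empty, false_iff]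
      rintro ⟨-, k', h1, h2, -⟩
      omega
  · rintro k s' hk ⟨-, hr, hm, h12, hR', Q, hQ', hQ⟩
    have inner := run_forDown (W := W) (r := 11) (T := solveTime n p φ.length N + 12)
      (K := N) (e := .reg 6) (s := s'.setr 10 k) (body := .tryPair)
      -- Besides the sources above `k`, the source `k` itself has been handled for all targets from
      -- `l` on.
      (fun l s' => l ≤ N ∧ s'.reg 10 = k ∧ (∀ r < 10, s'.reg r = s.reg r) ∧
        (∀ a < s.reg 0, s'.mem a = s.mem a) ∧
        (l < N → s'.reg 12 = s.reg 9 + (encFormula φ).length) ∧ Arr s'.mem (s.reg 5) N R ∧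
        ∃ Q, Arr s'.mem (s.reg 7) N Q ∧
          ∀ l', l' ∈ Q ↔ l' < N ∧ ((∃ k' < N, k + 1 ≤ k' ∧ k' ∈ R ∧ Compatible p φ k' l') ∨
            (l ≤ l' ∧ k ∈ R ∧ Compatible p φ k l')))
      (by omega) (by omega) (by simp [RExpr.eval, hr, e6])
      (by simp [RExpr.Fits, hr, e6]; omega) ?_ ?_
    · refine inner.mono (by simp [RExpr.cost]) ?_
      rintro s2 ⟨-, g10, hr2, hm2, g12, hR2, Q2, hQ2, hQ2'⟩
      refine ⟨g10, by omega, hr2, hm2, fun _ => g12 hN, hR2, Q2, hQ2, fun l => ?_⟩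
      rw [hQ2']
      refine and_congr_right fun _ => ?_
      constructor
      · rintro (⟨k', h1, h2, h3⟩ | ⟨-, h⟩)
        · exact ⟨k', h1, by omega, h3⟩
        · exact ⟨k, hk, le_rfl, h⟩
      · rintro ⟨k', h1, h2, h3⟩
        rcases Nat.eq_or_lt_of_le h2 with rfl | h2
        · exact .inr ⟨Nat.zero_le _, h3⟩
        · exact .inl ⟨k', h1, h2, h3⟩
    · refine ⟨le_rfl, by simp, fun r h => ?_, hm, fun h => by omega, hR', Q, hQ', fun l => ?_⟩
      · have : r ≠ 10 ∧ r ≠ 11 := by omega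
        simp [this, hr r h]
      · rw [hQ]
        refine and_congr_right fun hl => ?_
        simp [hl.not_ge]
    · rintro l s2 hl ⟨-, g10, hr2, hm2, g12, hR2, Q2, hQ2, hQ2'⟩
      have hr2' : ∀ r < 10, (s2.setr 11 l).reg r = s.reg r := fun r h => by
        have : r ≠ 11 := by omega
        simp [this, hr2 r h]
      have f5 := hr2' 5 (by omega)
      have f7 := hr2' 7 (by omega)
      refine (run_tryPair (W := W) (p := p) (N := N) (φ := φ) (R := R) (Q := Q2)
        (hs.congr hr2' hm2) (by simp [g10, hk]) (by simp [hl]) (by rw [f5]; exact hR2)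
        (by rw [f7]; exact hQ2)).mono le_rfl ?_
      rw [f5, f7, hr2' 0 (by omega), hr2' 9 (by omega)]
      have f10 : (s2.setr 11 l).reg 10 = k := by simp [g10]
      have f11 : (s2.setr 11 l).reg 11 = l := by simp
      rw [f10, f11]
      rintro s3 ⟨hr3, hm3, h12, hR3, Q3, hQ3, hQ3'⟩
      refine ⟨by rw [hr3 11 (by omega), f11], by omega, by rw [hr3 10 (by omega), f10],
        fun r h => by rw [hr3 r (by omega), hr2' r h], fun a h => by rw [hm3 a h]; exact hm2 a h,
        fun _ => h12, hR3, Q3, hQ3, fun l' => ?_⟩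
      rw [hQ3', hQ2']
      constructor
      · rintro (⟨h1, h2 | ⟨h2, h3⟩⟩ | ⟨rfl, h1⟩)
        · exact ⟨h1, .inl h2⟩
        · exact ⟨h1, .inr ⟨by omega, h3⟩⟩
        · exact ⟨hl, .inr ⟨le_rfl, h1⟩⟩
      · rintro ⟨h1, h2 | ⟨h2, h3⟩⟩
        · exact .inl ⟨h1, .inl h2⟩
        · rcases Nat.eq_or_lt_of_le h2 with rfl | h2
          · exact .inr ⟨rfl, h3⟩
          · exact .inl ⟨h1, .inr ⟨h2, h3⟩⟩

/-! ## Correctness of the dynamic program -/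

/-- A reachable code is the end of a path with one code before and one after each stage; the
induction removes the last stage. -/
theorem mem_reach_iff {n p N : ℕ} (φs : List (Formula2 n)) (l : ℕ) :
    l ∈ reach p N φs ↔ ∃ κ : ℕ → ℕ, κ φs.length = l ∧ (∀ i ≤ φs.length, κ i < N) ∧
      ∀ i (h : i < φs.length), Compatible p φs[i] (κ i) (κ (i + 1)) := by
  induction φs using List.reverseRecOn generalizing l with
  | nil =>
    constructor
    · exact fun h => ⟨fun _ => l, rfl, fun _ _ => h, fun i hi => absurd hi (Nat.not_lt_zero i)⟩
    · rintro ⟨κ, rfl, h, -⟩; exact h _ le_rfl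
  | append_singleton φs φ ih =>
    rw [reach_concat]
    simp only [reachStep, Set.mem_ofPred_eq, List.length_append, List.length_singleton]
    constructor
    · rintro ⟨hl, k, hk, hc⟩
      obtain ⟨κ, rfl, h1, h2⟩ := (ih k).1 hk
      refine ⟨fun i => if i = φs.length + 1 then l else κ i, by simp, fun i hi => ?_,
        fun i hi => ?_⟩
      · simp only
        split
        · exact hl
        · exact h1 i (by omega)
      · rcases Nat.lt_or_ge i φs.length with hlt | hge
        · rw [List.getElem_append_left hlt]
          have e1 : i ≠ φs.length + 1 := by omega
          have e2 : i ≠ φs.length := by omega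
          simpa [e1, e2] using h2 i hlt
        · obtain rfl : i = φs.length := by omega
          simpa using hc
    · rintro ⟨κ, rfl, h1, h2⟩
      refine ⟨h1 _ le_rfl, κ φs.length, (ih _).2 ⟨κ, rfl, fun i hi => h1 i (by omega),
        fun i hi => ?_⟩, ?_⟩
      · have := h2 i (by omega)
        rwa [List.getElem_append_left hi] at this
      · have := h2 φs.length (by omega)
        simpa using this

/-- Each of the `p` distinct coded literals is true under both assignments, hence is the literal of
`f` at a variable where `f` and `g` agree. The agreeing variables therefore map onto a superset of
the coded set. -/
theorem le_card_of_extends {n p k : ℕ} {f g : Fin n → Bool} (hn : 0 < n) (hf : Extends p f k)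
    (hg : Extends p g k) : p ≤ (Finset.univ.filter fun x => f x = g x).card := by
  have hsub : (digitList (n + n) p k).toFinset ⊆
      (Finset.univ.filter fun x => f x = g x).image fun v => litIndex (v, f v) := by
    intro e he
    obtain ⟨l, rfl⟩ := exists_litIndex (digitList_lt (by omega) (List.mem_toFinset.1 he))
    have h1 := hf.2 l he
    have h2 := hg.2 l he
    refine Finset.mem_image.2 ⟨l.1, by simp [h1, h2], by rw [h1]⟩
  have h := (Finset.card_le_card hsub).trans Finset.card_image_le
  rwa [List.toFinset_card_of_nodup hf.1, digitList_length] at h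

/-- Any `p` variables on which `f` and `g` agree, each taken with its common value, give the digits
of the code. -/
theorem exists_extends {n p : ℕ} {f g : Fin n → Bool}
    (h : p ≤ (Finset.univ.filter fun x => f x = g x).card) :
    ∃ k < (n + n) ^ p, Extends p f k ∧ Extends p g k := by
  obtain ⟨T, hT, hcard⟩ := Finset.exists_subset_card_eq h
  have hlen : (T.toList.map fun v => litIndex (v, f v)).length = p := by simp [hcard]
  obtain ⟨k, hk, hdig⟩ := exists_digitList (b := n + n) (T.toList.map fun v => litIndex (v, f v))
    (by simp only [List.mem_map]; rintro e ⟨v, -, rfl⟩; exact litIndex_lt _)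
  rw [hlen] at hk hdig
  have hnd : (digitList (n + n) p k).Nodup := by
    rw [hdig]
    refine T.nodup_toList.map fun v w hvw => ?_
    exact congrArg Prod.fst (litIndex_injective hvw)
  have hmem : ∀ l : Literal n, litIndex l ∈ (digitList (n + n) p k).toFinset →
      l.1 ∈ T ∧ f l.1 = l.2 := by
    intro l hl
    rw [hdig, List.mem_toFinset, List.mem_map] at hl
    obtain ⟨v, hv, he⟩ := hl
    rw [← litIndex_injective he]
    exact ⟨by simpa using hv, rfl⟩
  refine ⟨k, hk, ⟨hnd, fun l hl => (hmem l hl).2⟩, hnd, fun l hl => ?_⟩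
  obtain ⟨h1, h2⟩ := hmem l hl
  have := (Finset.mem_filter.1 (hT h1)).2
  rw [← this, h2]

theorem card_agree_add {n : ℕ} (f g : Fin n → Bool) :
    (Finset.univ.filter fun x => f x = g x).card +
      (Finset.univ.filter fun x => f x ≠ g x).card = n := by
  rw [Finset.card_filter_add_card_filter_not]
  simp

/-- The numbers of agreeing and of differing variables add up to `n`, so at most `d` changes means
at least `n - d` agreements; for `d ≥ n` both conditions are void. -/
theorem reach_nonempty_iff (I : M2SAT) :
    (reach I.dual ((I.n + I.n) ^ I.dual) (List.ofFn I.Φ)).Nonempty ↔ I.Yes := by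
  have hn := I.n_pos
  constructor
  · rintro ⟨l, hl⟩
    obtain ⟨κ, -, -, hκ⟩ := (mem_reach_iff _ _).1 hl
    have hκ' : ∀ i : Fin I.τ, Compatible I.dual (I.Φ i) (κ i) (κ (i + 1)) := fun i => by
      simpa using hκ i (by simp)
    choose f hf1 hf2 hf3 using hκ'
    refine ⟨f, hf1, fun i j hij => ?_⟩
    have h1 := hf3 i
    have h2 := hf2 j
    rw [hij] at h1
    have := le_card_of_extends hn h1 h2
    have hsum := card_agree_add (f i) (f j)
    unfold M2SAT.dual at this
    omega
  · rintro ⟨f, hf, hd⟩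
    -- Clamping the index extends the sequence beyond its ends. At positions `0` and `τ`, which have
    -- only one neighbouring stage, `F (i - 1) = F i`, so a code exists there as well.
    let F : ℕ → Fin I.n → Bool := fun i => f ⟨min i (I.τ - 1), by have := I.τ_pos; omega⟩
    have hF : ∀ i : Fin I.τ, F i = f i := fun i => by
      simp only [F]; congr 1; ext; simp; omega
    have hcode : ∀ i, ∃ k < (I.n + I.n) ^ I.dual, Extends I.dual (F (i - 1)) k ∧
        Extends I.dual (F i) k := by
      intro i
      apply exists_extends
      by_cases hi : 0 < i ∧ i < I.τ
      · have := hd ⟨i - 1, by omega⟩ ⟨i, hi.2⟩ (by simp; omega)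
        rw [← hF ⟨i - 1, by omega⟩, ← hF ⟨i, hi.2⟩] at this
        have hsum := card_agree_add (F (i - 1)) (F i)
        simp only at this
        unfold M2SAT.dual
        omega
      · have : F (i - 1) = F i := by
          simp only [F]; congr 1; ext; simp; omega
        rw [this]
        simp [M2SAT.dual]
    choose κ hκ1 hκ2 hκ3 using hcode
    refine ⟨κ I.τ, (mem_reach_iff _ _).2 ⟨κ, by simp, fun i _ => hκ1 i, fun i hi => ?_⟩⟩
    have hi' : i < I.τ := by simpa using hi
    rw [List.getElem_ofFn]
    refine ⟨F i, ?_, hκ3 i, by simpa using hκ2 (i + 1)⟩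
    have := hF ⟨i, hi'⟩
    simp only at this
    rw [this]
    exact hf _

/-! ## The whole program -/

namespace RProg

/-- Compute the power of register `3` with the exponent in register `2` in register `6`. -/
def power : RProg :=
  .seq (.assign 6 (.const 1)) (.forDown 10 (.reg 2)
    (.seq (.assign 11 (.const 0)) (.seq (.forDown 12 (.reg 3)
      (.assign 11 (.add (.reg 11) (.reg 6)))) (.assign 6 (.reg 11)))))

/-- Read the header of the input and set up the memory layout. -/
def setup : RProg :=
  .seq (.assign 1 (.mem (.const 0)))
  (.seq (.assign 2 (.sub (.reg 1) (.mem (.const 1))))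
  (.seq (.assign 9 (.add (.reg 1) (.const 3)))
  (.seq (.assign 3 (.add (.reg 1) (.reg 1)))
  (.seq (.assign 4 (.add (.reg 0) (.reg 3)))
  (.seq (.assign 5 (.add (.reg 4) (.reg 3)))
  (.seq .power
  (.assign 7 (.add (.reg 5) (.reg 6)))))))))

/-- The algorithm for Multistage 2-SAT. -/
def multistage : RProg :=
  .seq .setup (.seq (.fill 5 6 1) (.seq (.forDown 8 (.mem (.const 2)) .stage)
    (.seq (.anyIn 5 6) (.assign 0 (.reg 31)))))

end RProg

/-- Multiplication is a loop of additions. The partial sums never exceed `n ^ p`, so they fit into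
words. -/
theorem run_power {W n p : ℕ} {s : RState} (h2 : s.reg 2 = p) (h3 : s.reg 3 = n) (hn : 0 < n)
    (hW : n ^ p + n + p ≤ W) :
    Run W .power s (p * (n * 10 + 14) + 6) fun s' => (∀ r < 6, s'.reg r = s.reg r) ∧
      s'.reg 9 = s.reg 9 ∧ s'.mem = s.mem ∧ s'.reg 6 = n ^ p := by
  simp only [Run, RProg.power, wp_seq, wp_assign, RExpr.Fits, RExpr.eval, RExpr.cost]
  refine ⟨by omega, ?_⟩
  have outer := run_forDown (W := W) (r := 10) (T := n * 10 + 8) (K := p) (e := .reg 2)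
    (s := s.setr 6 1)
    (body := (.seq (.assign 11 (.const 0)) (.seq (.forDown 12 (.reg 3)
      (.assign 11 (.add (.reg 11) (.reg 6)))) (.assign 6 (.reg 11)))))
    (fun k s' => (∀ r < 6, s'.reg r = s.reg r) ∧ s'.reg 9 = s.reg 9 ∧ s'.mem = s.mem ∧
      k ≤ p ∧ s'.reg 6 = n ^ (p - k))
    (by omega) (by omega) (by simp [RExpr.eval, h2]) (by simp [RExpr.Fits, h2]; omega) ?_ ?_
  · refine outer.wp ?_
    rintro t s' ht ⟨h1, h2, h3, -, h4⟩
    exact ⟨by simp only [RExpr.cost] at ht; rw [show n * 10 + 8 + 6 = n * 10 + 14 by ring] at ht; omega, h1, h2, h3, by simpa using h4⟩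
  · refine ⟨fun r h => ?_, by simp, by simp, le_rfl, by simp⟩
    have : r ≠ 10 ∧ r ≠ 6 := by omega
    simp [this]
  · rintro k s' hk ⟨hr, h9, hm, -, h6⟩
    have hpow : n ^ (p - k) ≤ n ^ p := Nat.pow_le_pow_right hn (by omega)
    have hpow' : n * n ^ (p - (k + 1)) = n ^ (p - k) := by
      rw [← pow_succ', show p - (k + 1) + 1 = p - k by omega]
    simp only [Run, wp_seq, wp_assign, RExpr.Fits, RExpr.eval, RExpr.cost]
    refine ⟨by omega, ?_⟩
    have inner := run_forDown (W := W) (r := 12) (T := 4) (K := n) (e := .reg 3)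
      (s := (s'.setr 10 k).setr 11 0) (body := (.assign 11 (.add (.reg 11) (.reg 6))))
      (fun j s' => j ≤ n ∧ (∀ r < 6, s'.reg r = s.reg r) ∧ s'.reg 9 = s.reg 9 ∧ s'.mem = s.mem ∧
        s'.reg 10 = k ∧ s'.reg 6 = n ^ (p - (k + 1)) ∧
        s'.reg 11 = (n - j) * n ^ (p - (k + 1)))
      (by omega) (by omega) (by simp [RExpr.eval, hr, h3]) (by simp [RExpr.Fits, hr, h3]; omega)
      ?_ ?_
    · refine inner.wp ?_
      rintro t s2 ht ⟨-, hr2, h92, hm2, h10, h62, h11⟩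
      simp only [Nat.sub_zero, hpow'] at h11
      refine ⟨by omega, by simp only [RExpr.cost] at ht; omega, by simpa using h10,
        fun r h => ?_, by simpa using h92, by simpa using hm2, by omega, by simpa using h11⟩
      have : r ≠ 6 := by omega
      simp [this, hr2 r h]
    · refine ⟨le_rfl, fun r h => ?_, by simp [h9], by simp [hm], by simp, by simp [h6], by simp⟩
      have : r ≠ 10 ∧ r ≠ 11 ∧ r ≠ 12 := by omega
      simp [this, hr r h]
    · rintro j s2 hj ⟨-, hr2, h92, hm2, h10, h62, h11⟩
      have e1 : (n - (j + 1)) * n ^ (p - (k + 1)) + n ^ (p - (k + 1)) =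
          (n - j) * n ^ (p - (k + 1)) := by
        rw [show n - j = n - (j + 1) + 1 by omega]; ring
      have e2 : (n - j) * n ^ (p - (k + 1)) ≤ n ^ (p - k) := by
        rw [← hpow']; exact Nat.mul_le_mul_right _ (by omega)
      simp only [Run, wp_assign, RExpr.Fits, RExpr.eval, RExpr.cost, RState.setr_reg,
        Nat.reduceEqDiff, if_false, if_true, h11, h62]
      refine ⟨by omega, by omega, trivial, by omega, fun r h => ?_, h92, by simpa using hm2, h10,
        trivial, e1⟩
      have : r ≠ 11 ∧ r ≠ 12 := by omega
      simp [this, hr2 r h]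

open M2SAT in
theorem encode_eq (I : M2SAT) : I.encode =
    I.n :: I.d :: I.τ :: (List.range I.n ++ (List.ofFn I.Φ).flatMap encFormula) := by
  simp [encode, List.flatMap_def, List.map_ofFn, Function.comp_def]

/-- The time bound of the algorithm. -/
def multistageTime (n p τ m N : ℕ) : ℕ :=
  p * (n * 20 + 14) + τ * (stageTime n p m N + 6) + N * 24 + 70

theorem solveTime_mono {n p m m' K : ℕ} (h : m ≤ m') : solveTime n p m K ≤ solveTime n p m' K := by
  unfold solveTime
  gcongr

theorem stageTime_mono {n p m m' N : ℕ} (h : m ≤ m') : stageTime n p m N ≤ stageTime n p m' N := by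
  unfold stageTime
  gcongr
  exact solveTime_mono h

theorem length_le_encFormula {n : ℕ} (φ : Formula2 n) :
    φ.length + 1 ≤ (M2SAT.encFormula φ).length := by
  simp only [M2SAT.encFormula, List.length_cons, Nat.add_le_add_iff_right]
  induction φ with
  | nil => simp
  | cons c φ ih => simp [M2SAT.encClause]; omega

theorem length_le_flatMap {n : ℕ} (φs : List (Formula2 n)) :
    φs.length ≤ (φs.flatMap M2SAT.encFormula).length := by
  induction φs with
  | nil => simp
  | cons φ φs ih => simp [M2SAT.encFormula]; omega

open M2SAT in
-- The working memory starts at register 0, which only needs to be at or beyond the end of the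
-- encoding; words appended to the instance are never read.
theorem run_multistage {W : ℕ} {I : M2SAT} {s : RState} (hin : Holds s.mem 0 I.encode)
    (hlen : I.encode.length ≤ s.reg 0) (hd : I.d ≤ W)
    (hW : s.reg 0 + 4 * I.n + 2 * (I.n + I.n) ^ I.dual + 4 ≤ W) :
    Run W .multistage s (multistageTime I.n I.dual I.τ I.m ((I.n + I.n) ^ I.dual))
      fun s' => s'.reg 0 = 1 ↔ I.Yes := by
  have hn := I.n_pos
  set n := I.n with hn_def
  set p := I.dual with hp_def
  set N := (n + n) ^ p with hN_def
  have hp : p ≤ n := Nat.sub_le _ _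
  have hN : 0 < N := Nat.pow_pos (by omega)
  rw [encode_eq] at hin hlen
  obtain ⟨hi0, hi1, hi2, hin⟩ := hin
  rw [holds_append, List.length_range] at hin
  simp only [List.length_cons, List.length_append, List.length_range] at hlen
  have hτ := length_le_flatMap (List.ofFn I.Φ)
  rw [List.length_ofFn] at hτ
  simp only [zero_add, Nat.reduceAdd] at hi0 hi1 hi2 hin
  simp only [Run, RProg.multistage, RProg.setup, wp_seq, wp_assign, RExpr.Fits, RExpr.eval,
    RExpr.cost, RState.setr_reg, RState.setr_mem, Nat.reduceEqDiff, if_true, if_false, hi0, hi1]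
  refine ⟨by omega, by omega, by omega, by omega, by omega, by omega, ?_⟩
  refine (run_power (W := W) (n := n + n) (p := p) (by simp [hp_def, dual]) (by simp; omega)
    (by omega) (by omega)).wp ?_
  rintro t1 s1 ht1 ⟨hr1, h91, hm1, h61⟩
  have r0 := hr1 0 (by omega)
  have r1 := hr1 1 (by omega)
  have r2 := hr1 2 (by omega)
  have r3 := hr1 3 (by omega)
  have r4 := hr1 4 (by omega)
  have r5 := hr1 5 (by omega)
  simp only [RState.setr_reg, RState.setr_mem, Nat.reduceEqDiff, if_true, if_false]
    at r0 r1 r2 r3 r4 r5 h91 hm1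
  simp only [r5, h61]
  refine ⟨by omega, ?_⟩
  refine (run_fill (W := W) (b := 5) (len := 6) (v := 1) (by omega) (by omega) (by omega)
    (by simp [r5, h61]; omega)).wp ?_
  simp only [RState.setr_reg, Nat.reduceEqDiff, if_false, r5, h61]
  rintro t2 s2 ht2 ⟨⟨hr2, hm2⟩, hfill⟩
  simp only [RState.setr_reg, RState.setr_mem, hm1] at hr2 hm2
  have q : ∀ r < 7, s2.reg r = s1.reg r := fun r h => by
    rw [hr2 r (by omega), if_neg (by omega)]
  have q0 : s2.reg 0 = s.reg 0 := by rw [q 0 (by omega), r0]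
  have hm2' : ∀ a < s.reg 0, s2.mem a = s.mem a := fun a h => hm2 a (by omega)
  -- Registers 0 to 7 do not change from here on, so the context of each stage depends only on where
  -- its formula lies.
  have hctx : ∀ φ : Formula2 n, ∀ s' : RState, (∀ r < 8, s'.reg r = s2.reg r) →
      Holds s'.mem (s'.reg 9) (encFormula φ) → s'.reg 9 + (encFormula φ).length ≤ s.reg 0 →
      StageCtx W p N φ s' := by
    intro φ s' hr h1 h2
    have g0 : s'.reg 0 = s.reg 0 := by rw [hr 0 (by omega), q0]
    have := length_le_encFormula φ
    refine ⟨⟨hn, ?_, ?_, ?_, ?_, h1, by omega, by omega, by omega, by omega⟩, ?_, ?_, ?_, hN,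
      by omega⟩
    · rw [hr 1 (by omega), q 1 (by omega), r1]
    · rw [hr 2 (by omega), q 2 (by omega), r2]; rfl
    · rw [hr 3 (by omega), q 3 (by omega), r3]
    · rw [hr 4 (by omega), q 4 (by omega), r4, g0]
    · rw [hr 5 (by omega), q 5 (by omega), r5, g0]; omega
    · rw [hr 6 (by omega), q 6 (by omega), h61]
    · rw [hr 7 (by omega), hr2 7 (by omega), if_pos rfl, g0]; omega
  have q5 : s2.reg 5 = s.reg 0 + 4 * n := by rw [q 5 (by omega), r5]; omega
  have q6 : s2.reg 6 = N := by rw [q 6 (by omega), h61]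
  -- The formulas start after the three header words and the list of the `n` variables.
  have q9 : s2.reg 9 = n + 3 := by rw [hr2 9 (by omega), if_neg (by omega), h91]
  have key := run_forDown (W := W) (r := 8) (T := stageTime n p I.m N) (K := I.τ)
    (e := .mem (.const 2)) (s := s2) (body := .stage)
    (fun i s' => (∀ r < 8, s'.reg r = s2.reg r) ∧ (∀ a < s.reg 0, s'.mem a = s.mem a) ∧
      ∃ pre suf, List.ofFn I.Φ = pre ++ suf ∧ suf.length = i ∧
        Holds s.mem (s'.reg 9) (suf.flatMap encFormula) ∧
        s'.reg 9 + (suf.flatMap encFormula).length ≤ s.reg 0 ∧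
        ∃ R ⊆ Finset.range N, Arr s'.mem (s.reg 0 + 4 * n) N R ∧ ∀ l, l ∈ R ↔ l ∈ reach p N pre)
    (by omega) (by omega) ?_ ?_ ?_ ?_
  · refine key.wp ?_
    rintro t3 s3 ht3 ⟨hr3, hm3, pre, suf, hφs, hsuf, -, -, R, hRN, hR, hreach⟩
    obtain rfl := List.length_eq_zero_iff.1 hsuf
    rw [List.append_nil] at hφs
    subst hφs
    have u5 : s3.reg 5 = s.reg 0 + 4 * n := by rw [hr3 5 (by omega), q5]
    have u6 : s3.reg 6 = N := by rw [hr3 6 (by omega), q6]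
    refine (run_anyIn (W := W) (L := R) (by omega) (by omega) (by omega) (by omega)
      (by rw [u5, u6]; exact hR) (by rw [u6]; exact hRN)).wp ?_
    rw [u6]
    rintro t4 s4 ht4 ⟨hle, hiff⟩
    refine ⟨by omega, ?_, ?_⟩
    · simp only [RExpr.cost] at ht3
      rw [show (n + n) * 10 + 14 = n * 20 + 14 by ring] at ht1
      unfold multistageTime
      omega
    · rw [hiff, ← reach_nonempty_iff]
      exact exists_congr hreach
  · simp only [RExpr.eval]; rw [hm2' 2 (by omega), hi2]
  · simp only [RExpr.eval, RExpr.Fits]; rw [hm2' 2 (by omega), hi2]; omega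
  -- Before the first stage every code is admissible, which is why the array was filled with ones.
  · refine ⟨fun r h => by simp [h.ne], hm2', [], List.ofFn I.Φ, rfl, by simp,
      ?_, ?_, Finset.range N, subset_rfl, ?_, by simp [reach]⟩
    · have := hin.2
      rw [Nat.add_comm] at this
      simpa [q9] using this
    · simp only [RState.setr_reg, Nat.reduceEqDiff, if_false, q9]; omega
    · intro e he
      have : s1.reg 5 = s.reg 0 + 4 * n := by rw [r5]; omega
      simp only [RState.setr_mem]
      rw [show s.reg 0 + 4 * n = s.reg 0 + (n + n) + (n + n) by omega, hfill e he]
      simp [he]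
  · rintro i s' hi ⟨hr, hm, pre, suf, hφs, hsuf, hh, hle, R, hRN, hR, hreach⟩
    obtain ⟨φ, suf, rfl⟩ := List.exists_cons_of_length_eq_add_one hsuf
    rw [List.flatMap_cons, holds_append] at hh
    rw [List.flatMap_cons, List.length_append] at hle
    have hr' : ∀ r < 8, (s'.setr 8 i).reg r = s2.reg r := fun r h => by
      simp [h.ne, hr r h]
    have hφ : φ.length ≤ I.m := by
      have : φ ∈ List.ofFn I.Φ := by rw [hφs]; simp
      obtain ⟨j, rfl⟩ := (List.mem_ofFn' _ _).1 this
      exact Finset.le_sup (f := fun i => (I.Φ i).length) (Finset.mem_univ j)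
    have v9 : (s'.setr 8 i).reg 9 = s'.reg 9 := by simp
    have v0 : (s'.setr 8 i).reg 0 = s.reg 0 := by rw [hr' 0 (by omega), q0]
    have v5 : (s'.setr 8 i).reg 5 = s.reg 0 + 4 * n := by rw [hr' 5 (by omega), q5]
    refine (run_stage (W := W) (R := R) (hctx φ _ hr' ?_ (by rw [v9]; omega)) ?_).mono
      (stageTime_mono hφ) ?_
    · rw [v9]
      exact hh.1.congr fun a _ h => hm a (by omega)
    · rw [v5]; exact hR
    rw [v0, v5, v9]
    rintro s'' ⟨hr3, hm3, h9, R', hR', hiff⟩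
    refine ⟨by rw [hr3 8 (by omega)]; simp, fun r h => by rw [hr3 r (by omega), hr' r h],
      fun a h => by rw [hm3 a h]; exact hm a h, pre ++ [φ], suf, by simp [hφs],
      by simpa using hsuf, by rw [h9]; exact hh.2, by omega, R', ?_, hR', fun l => ?_⟩
    · intro l hl; exact Finset.mem_range.2 ((hiff l).1 hl).1
    · rw [hiff, reach_concat]
      refine and_congr_right fun _ => exists_congr fun k => ?_
      rw [← hreach]
      refine ⟨fun h => h.2, fun h => ⟨Finset.mem_range.1 (hRN h.1), h⟩⟩

/-! ## Time bounds and the theorem -/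

/-- A test costs `O(N n (n + m))`, where the factor `N` pays for decoding, and a stage makes `N^2`
tests. This gives `N^3`; the last factor `N` is slack. -/
theorem multistageTime_le {n p τ m N : ℕ} (hn : 0 < n) (hτ : 0 < τ) (hp : p ≤ n) (hN : 0 < N) :
    multistageTime n p τ m N ≤ 1100 * (N ^ 4 * n * τ * (n + m)) := by
  have hsolve : solveTime n p m N ≤ 856 * (N * n * (n + m)) := by
    have h1 : p * (N * 14 + 30) ≤ n * (N * 44) := Nat.mul_le_mul hp (by omega)
    have h2 : (n + 1) * (m * 260 + n * 106 + 102) ≤ (2 * n) * (260 * (n + m)) :=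
      Nat.mul_le_mul (by omega) (by omega)
    have h3 : n * N ≤ N * n * (n + m) := by
      calc n * N = N * n * 1 := by ring
        _ ≤ _ := Nat.mul_le_mul_left _ (by omega)
    have h4 : n * (n + m) ≤ N * n * (n + m) := by
      calc n * (n + m) = 1 * n * (n + m) := by ring
        _ ≤ _ := by gcongr; omega
    have h5 : n ≤ n * (n + m) := Nat.le_mul_of_pos_right _ (by omega)
    have e1 : n * (N * 44) = 44 * (n * N) := by ring
    have e2 : (2 * n) * (260 * (n + m)) = 520 * (n * (n + m)) := by ring
    unfold solveTime
    omega
  have hX : N ≤ N ^ 3 * n * (n + m) := by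
    calc N = N * 1 * 1 * 1 := by ring
      _ ≤ N * N ^ 2 * n * (n + m) := by gcongr <;> first | omega | exact Nat.pow_pos hN
      _ = _ := by ring
  have hstage : stageTime n p m N ≤ 929 * (N ^ 3 * n * (n + m)) := by
    have h1 : N * (N * (solveTime n p m N + 18) + 10) ≤
        N * (N * (856 * (N * n * (n + m)) + 18) + 10) := by gcongr
    have e1 : N * (N * (856 * (N * n * (n + m)) + 18) + 10) =
        856 * (N ^ 3 * n * (n + m)) + 18 * (N ^ 2) + 10 * N := by ring
    have h2 : N ^ 2 ≤ N ^ 3 * n * (n + m) := by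
      calc N ^ 2 = N ^ 2 * 1 * 1 * 1 := by ring
        _ ≤ N ^ 2 * N * n * (n + m) := by gcongr <;> omega
        _ = _ := by ring
    unfold stageTime
    omega
  have h1 : τ * (stageTime n p m N + 6) ≤ 935 * (N ^ 4 * n * τ * (n + m)) := by
    calc τ * (stageTime n p m N + 6) ≤ τ * (935 * (N ^ 3 * n * (n + m))) := by gcongr; omega
      _ = 935 * (N ^ 3 * n * τ * (n + m)) := by ring
      _ ≤ _ := by (gcongr; omega)
  have h2 : p * (n * 20 + 14) ≤ 34 * (N ^ 4 * n * τ * (n + m)) := by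
    calc p * (n * 20 + 14) ≤ n * (34 * (n + m)) := Nat.mul_le_mul hp (by omega)
      _ = 34 * (1 * n * 1 * (n + m)) := by ring
      _ ≤ _ := by gcongr <;> first | omega | exact Nat.pow_pos hN
  have h3 : N ≤ N ^ 4 * n * τ * (n + m) := by
    calc N ≤ N ^ 3 * n * (n + m) := hX
      _ = N ^ 3 * n * 1 * (n + m) := by ring
      _ ≤ _ := by gcongr <;> omega
  unfold multistageTime
  omega

/-- The working memory is bounded by the claimed time, so every address respects the word bound. -/
theorem space_le {n τ m N : ℕ} (hn : 0 < n) (hτ : 0 < τ) (hN : 0 < N) :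
    4 * n + 2 * N + 4 ≤ 10 * (N ^ 4 * n * τ * (n + m)) := by
  have h1 : n ≤ N ^ 4 * n * τ * (n + m) := by
    calc n = 1 * n * 1 * 1 := by ring
      _ ≤ _ := by gcongr <;> first | omega | exact Nat.pow_pos hN
  have h2 : N ≤ N ^ 4 * n * τ * (n + m) := by
    calc N = N * 1 * 1 * 1 * 1 := by ring
      _ ≤ N * N ^ 3 * n * τ * (n + m) := by gcongr <;> first | omega | exact Nat.pow_pos hN
      _ = _ := by ring
  omega

theorem holds_of_getElem {mem : ℕ → ℕ} {a : ℕ} {w : List ℕ}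
    (h : ∀ i (hi : i < w.length), mem (a + i) = w[i]) : Holds mem a w := by
  induction w generalizing a with
  | nil => trivial
  | cons x w ih =>
    refine ⟨h 0 (by simp), ih fun i hi => ?_⟩
    have := h (i + 1) (by simpa using hi)
    rw [show a + 1 + i = a + (i + 1) by omega, this]
    rfl

theorem le_foldr_max {x : ℕ} {w : List ℕ} (h : x ∈ w) : x ≤ w.foldr max 0 := by
  induction w with
  | nil => simp at h
  | cons y w ih =>
    rcases List.mem_cons.1 h with rfl | h
    · exact le_max_left _ _
    · exact (ih h).trans (le_max_right _ _)

/-- The suffix `w` is empty for the time bound and consists of the parameter for XP. The program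
computes `n - d` itself. The number `d` may be huge; it fits because the word bound includes the
largest input word. -/
theorem multistage_decidesIn (I : M2SAT) (w : List ℕ) {T : ℕ}
    (hT : 1100 * (((I.n + I.n) ^ I.dual) ^ 4 * I.n * I.τ * (I.n + I.m)) ≤ T) :
    RProg.multistage.DecidesIn (I.encode ++ w) I.Yes T := by
  have hN : 0 < (I.n + I.n) ^ I.dual := Nat.pow_pos (by have := I.n_pos; omega)
  have hspace := space_le (m := I.m) I.n_pos I.τ_pos hN
  have hd : I.d ≤ (I.encode ++ w).foldr max 0 := le_foldr_max (by simp [M2SAT.encode])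
  have hlen : (I.encode ++ w).length = (RState.init (I.encode ++ w)).reg 0 := by simp [RState.init]
  obtain ⟨t, s, hexec, ht, hs⟩ := run_multistage
    (W := T + (I.encode ++ w).length + (I.encode ++ w).foldr max 0) (I := I)
    (s := RState.init (I.encode ++ w))
    (holds_of_getElem fun i hi => by
      simp [RState.init, List.getD_eq_getElem?_getD, List.getElem?_append_left hi,
        List.getElem?_eq_getElem hi])
    (by rw [← hlen]; simp) (by omega) (by rw [← hlen]; omega)
  exact ⟨t, s, ht.trans ((multistageTime_le I.n_pos I.τ_pos (Nat.sub_le _ _) hN).trans hT),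
    hexec, hs⟩

theorem length_le_bitLength (w : List ℕ) : w.length ≤ bitLength w := by
  induction w with
  | nil => simp
  | cons x w ih => simp only [bitLength, List.map_cons, List.sum_cons, List.length_cons] at ih ⊢; omega

/-- Listing the variables contributes `n` words, and each clause and each stage contributes at least
one word. -/
theorem M2SAT.add_le_length_encode (I : M2SAT) :
    I.n + I.m + 2 ≤ I.encode.length ∧ I.τ ≤ I.encode.length := by
  rw [encode_eq]
  simp only [List.length_cons, List.length_append, List.length_range]
  have hτ := length_le_flatMap (List.ofFn I.Φ)
  rw [List.length_ofFn] at hτ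
  have hm : I.m ≤ ((List.ofFn I.Φ).flatMap encFormula).length := by
    refine Finset.sup_le fun i _ => ?_
    have hmem : I.Φ i ∈ List.ofFn I.Φ := (List.mem_ofFn' _ _).2 ⟨i, rfl⟩
    obtain ⟨u, v, h⟩ := List.append_of_mem hmem
    have := length_le_encFormula (I.Φ i)
    rw [h, List.flatMap_append, List.flatMap_cons, List.length_append, List.length_append]
    omega
  omega

theorem time_le_bitLength (I : M2SAT) :
    1100 * (((I.n + I.n) ^ I.dual) ^ 4 * I.n * I.τ * (I.n + I.m)) ≤
      bitLength I.encode ^ (8 * I.dual + 14) := by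
  obtain ⟨h1, h2⟩ := I.add_le_length_encode
  have h3 := length_le_bitLength I.encode
  set x := bitLength I.encode
  have hx : 2 ≤ x := by omega
  have hnx : I.n + I.n ≤ x ^ 2 := by
    calc I.n + I.n = 2 * I.n := by ring
      _ ≤ x * x := Nat.mul_le_mul hx (by omega)
      _ = x ^ 2 := by ring
  -- With `2n ≤ x^2` the power `N^4` is at most `x^(8p)`; three more factors bound `n`, `τ`, `n +
  -- m`, and `1100 ≤ 2^11 ≤ x^11`, so the exponent is `8p + 3 + 11`.
  calc 1100 * (((I.n + I.n) ^ I.dual) ^ 4 * I.n * I.τ * (I.n + I.m))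
      ≤ 2 ^ 11 * (((x ^ 2) ^ I.dual) ^ 4 * x * x * x) := by
        gcongr <;> omega
    _ ≤ x ^ 11 * (((x ^ 2) ^ I.dual) ^ 4 * x * x * x) := by gcongr
    _ = x ^ (8 * I.dual + 14) := by
        rw [← pow_mul, ← pow_mul]; ring

theorem mainTheorem4 :
    (∃ (P : RProg) (C : ℕ), ∀ I : M2SAT,
      P.DecidesIn I.encode I.Yes
        (C * (I.n ^ (4 * I.dual + 1) * 2 ^ (4 * I.dual) * I.τ * (I.n + I.m)))) ∧
    InXP M2SAT.encode M2SAT.dual M2SAT.Yes := by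
  constructor
  · refine ⟨RProg.multistage, 1100, fun I => ?_⟩
    have h := multistage_decidesIn I [] le_rfl
    rw [List.append_nil] at h
    convert h using 2
    -- This is the identity `((2n)^p)^4 · n = n^(4p+1) · 2^(4p)`.
    rw [← two_mul, mul_pow, mul_pow, ← pow_mul, ← pow_mul, mul_comm I.dual 4, pow_succ]
    ring
  · refine ⟨RProg.multistage, fun p => 8 * p + 14, ?_, fun I => ?_⟩
    · exact (Primrec.nat_add.comp (Primrec.nat_mul.comp (Primrec.const 8) Primrec.id)
        (Primrec.const 14)).to_comp
    · exact multistage_decidesIn I _ ((time_le_bitLength I).trans (Nat.le_add_right _ _))
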